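/- Let $d\ge 1$, $\beta>0$, and let $\phi:\mathbb R^d\times\mathbb R^d\to[0,+\infty]$ be a measurable pair interaction that is symmetric, $\phi(x,y)=\phi(y,x)$, and translation invariant, $\phi(x+a,y+a)=\phi(x,y)$ (for instance $\phi(x,y)=\phi(|x-y|)$). Put $e^{-\infty}=0$ and assume that $$C(\beta)=\int_{\mathbb R^d}\bigl|e^{-\beta\phi(x,0)}-1\bigr|\,dx<\infty .$$ For measurable $\Lambda\subset\mathbb R^d$ with $0<|\Lambda|<\infty$ (a region) and $z\in\mathbb C$ let $$\Xi_\Lambda(z)=1+\sum_{N\ge1}\frac{z^N}{N!}\int_{\Lambda^N}\exp\Bigl(-\beta\sum_{1\le i<j\le N}\phi(x_i,x_j)\Bigr)dx_1\cdots dx_N ,\qquad \beta P_\Lambda(z)=\frac1{|\Lambda|}\ln\Xi_\Lambda(z),$$ where $\ln\Xi_\Lambda$ is the continuous branch that vanishes at $z=0$, and let $b_n(\Lambda)$ be the $n$-th derivative of $\beta P_\Lambda$ at $z=0$. Let $$g(n)=\int_{\mathbb R^{dn}}\prod_{1\le i\le n}\bigl[1-e^{-\beta\phi(0,x_i)}\bigr]\prod_{1\le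 i<j\le n}e^{-\beta\phi(x_i,x_j)}\,dx_1\cdots dx_n,\qquad \Psi(\mu)=1+\sum_{n\ge1}\frac{\mu^n}{n!}g(n).$$ The limit $\Lambda\uparrow\mathbb R^d$ is understood in the sense of van Hove: along any sequence of regions $\Lambda_k$ such that $|\Lambda_k|\to\infty$ and, for every $h>0$, $|\{x:\operatorname{dist}(x,\partial\Lambda_k)\le h\}|/|\Lambda_k|\to0$. **Theorem.** Let $\mu>0$ and $D=\{z\in\mathbb C:|z|\le\mu/\Psi(\mu)\}$. Then: (i) For every region $\Lambda$ the branch $\beta P_\Lambda$ exists on $D$ (in particular $\Xi_\Lambda$ has no zero there), and the finite-volume cluster expansion $$\beta P_\Lambda(z)=\sum_{n\ge1}\frac{b_n(\Lambda)}{n!}z^n$$ converges uniformly in $z\in D$ and in $\Lambda$. The limits $b_n=\lim_{\Lambda\uparrow\mathbb R^d}b_n(\Lambda)$ and $\beta p(z)=\lim_{\Lambda\uparrow\mathbb R^d}\beta P_\Lambda(z)$, the latter uniformly in $z\in D$, exist and do not depend on the sequence of regions, and the infinite-volume cluster expansion $$\beta p(z)=\sum_{n\ge1}\frac{b_n}{n!}z^n$$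 converges uniformly in $z\in D$. (ii) $|\beta P_\Lambda(z)|\le\mu$ for every region $\Lambda$ and every $z\in D$, and $|\beta p(z)|\le\mu$ for every $z\in D$. -/

import Mathlib

open scoped ENNReal Topology
open MeasureTheory Filter

noncomputable section

namespace RepulsiveGas

/-- The physical space `ℝ^d` with its Euclidean norm and Lebesgue measure. -/
abbrev Space (d : ℕ) : Type := EuclideanSpace ℝ (Fin d)

/-- The Boltzmann factor `exp (-β u)` of an energy `u ∈ [0, ∞]`, with `exp (-β ∞) = 0`. -/
def boltzmann (β : ℝ) (u : ℝ≥0∞) : ℝ :=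
  if u = ⊤ then 0 else Real.exp (-β * u.toReal)

/-- The standing assumptions on a pair interaction `φ : ℝ^d × ℝ^d → [0, ∞]`: it is measurable,
symmetric and translation invariant. Repulsiveness is built into its codomain. -/
structure IsInteraction {d : ℕ} (φ : Space d → Space d → ℝ≥0∞) : Prop where
  measurable : Measurable (Function.uncurry φ)
  symm : ∀ x y, φ x y = φ y x
  translation : ∀ a x y, φ (x + a) (y + a) = φ x y

/-- The temperedness constant `C(β) = ∫ |exp (-β φ(x, 0)) - 1| dx`, possibly infinite. -/
def temperedness {d : ℕ} (β : ℝ) (φ : Space d → Space d → ℝ≥0∞) : ℝ≥0∞ :=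
  ∫⁻ x : Space d, ENNReal.ofReal |boltzmann β (φ x 0) - 1|

/-- The energy `U_N(x_1, …, x_N) = ∑_{i < j} φ(x_i, x_j)`. -/
def energy {d : ℕ} (φ : Space d → Space d → ℝ≥0∞) {N : ℕ} (x : Fin N → Space d) : ℝ≥0∞ :=
  ∑ i, ∑ j ∈ Finset.Ioi i, φ (x i) (x j)

/-- The grand canonical partition function `Ξ_Λ(z)` at a complex fugacity `z`. -/
def partitionFunction {d : ℕ} (β : ℝ) (φ : Space d → Space d → ℝ≥0∞) (Λ : Set (Space d))
    (z : ℂ) : ℂ :=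
  1 + ∑' N : ℕ, z ^ (N + 1) / ((N + 1).factorial : ℂ) *
    ((∫ x in Set.univ.pi (fun _ : Fin (N + 1) => Λ), boltzmann β (energy φ x) : ℝ) : ℂ)

/-- Finite regions: measurable sets of finite and positive volume. -/
structure IsRegion {d : ℕ} (Λ : Set (Space d)) : Prop where
  measurableSet : MeasurableSet Λ
  volume_ne_zero : volume Λ ≠ 0
  volume_ne_top : volume Λ ≠ ⊤

/-- `P` is the finite-volume pressure `z ↦ β P_Λ(z) = |Λ|⁻¹ ln Ξ_Λ(z)` on the set `D ∋ 0` of complex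
fugacities. The logarithm is the continuous branch on `D` with `ln Ξ_Λ(0) = ln 1 = 0`; for connected
`D` there is at most one such `P` on `D`, and there is none if `Ξ_Λ` has a zero in `D`. -/
structure IsPressure {d : ℕ} (β : ℝ) (φ : Space d → Space d → ℝ≥0∞) (Λ : Set (Space d))
    (D : Set ℂ) (P : ℂ → ℂ) : Prop where
  continuousOn : ContinuousOn P D
  at_zero : P 0 = 0
  exp_eq : ∀ z ∈ D, Complex.exp ((volume.real Λ : ℂ) * P z) = partitionFunction β φ Λ z

/-- The coefficient `b_n(Λ)` of the finite-volume cluster expansion, that is, the `n`-th derivative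
at `z = 0` of `|Λ|⁻¹ ln Ξ_Λ(z)`. As `Ξ_Λ(0) = 1`, the principal branch is the right one near `0`. -/
def clusterCoeff {d : ℕ} (β : ℝ) (φ : Space d → Space d → ℝ≥0∞) (Λ : Set (Space d)) (n : ℕ) : ℂ :=
  iteratedDeriv n (fun z : ℂ => Complex.log (partitionFunction β φ Λ z) / (volume.real Λ : ℂ)) 0

/-- The `N`-th partial sum `∑_{n=1}^N a_n z^n / n!` of a cluster expansion with coefficients `a`. -/
def partialExpansion (a : ℕ → ℂ) (N : ℕ) (z : ℂ) : ℂ :=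
  ∑ n ∈ Finset.Icc 1 N, a n / (n.factorial : ℂ) * z ^ n

/-- `Λ_k ↑ ℝ^d` in the sense of van Hove: the volumes tend to infinity, and for each `h > 0` the
volume of the set of points at distance at most `h` from the boundary of `Λ_k` is negligible
compared with the volume of `Λ_k`. Sequences that grow in the sense of Fisher are of this kind. -/
structure IsVanHove {d : ℕ} (Λ : ℕ → Set (Space d)) : Prop where
  isRegion : ∀ k, IsRegion (Λ k)
  volume_tendsto : Tendsto (fun k => volume (Λ k)) atTop (𝓝 ⊤)
  boundary_tendsto : ∀ h : ℝ, 0 < h →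
    Tendsto (fun k => volume (Metric.cthickening h (frontier (Λ k))) / volume (Λ k)) atTop (𝓝 0)

/-- `φ_n(x; x_1, …, x_n) = ∏_i [1 - exp (-β φ(x, x_i))] ∏_{i < j} exp (-β φ(x_i, x_j))`. -/
def siblingWeight {d : ℕ} (β : ℝ) (φ : Space d → Space d → ℝ≥0∞) {n : ℕ} (x : Space d)
    (y : Fin n → Space d) : ℝ :=
  (∏ i, (1 - boltzmann β (φ x (y i)))) *
    ∏ i, ∏ j ∈ Finset.Ioi i, boltzmann β (φ (y i) (y j))

/-- `g(n) = ∫ φ_n(0; x_1, …, x_n) dx_1 ⋯ dx_n`. -/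
def siblingIntegral {d : ℕ} (β : ℝ) (φ : Space d → Space d → ℝ≥0∞) (n : ℕ) : ℝ :=
  ∫ y : Fin n → Space d, siblingWeight β φ 0 y

/-- The vertex sum `Ψ(μ) = 1 + ∑_{n ≥ 1} μ^n / n! g(n)`. -/
def vertexSum {d : ℕ} (β : ℝ) (φ : Space d → Space d → ℝ≥0∞) (μ : ℝ) : ℝ :=
  1 + ∑' n : ℕ, μ ^ (n + 1) / ((n + 1).factorial : ℝ) * siblingIntegral β φ (n + 1)

end RepulsiveGas

end

namespace RepulsiveGas

/-! For a repulsive gas the Taylor coefficients of the correlation functions alternate in sign.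
Expanding the Boltzmann factors between one distinguished point and the integrated points as `1 - (1
- e)` gives the Kirkwood-Salsburg equations (`gasIntegral_cons`). Under `z ↦ -z` they become a
recursion with nonnegative terms, and `corr` is its solution. With values in `[0, ∞]` it makes sense
for infinite volume as well.

The decisive estimate is `sum_corr_le`: if `r Ψ(μ) ≤ μ`, then the partial sums of the `n`-point
series at `r` are at most `μ ^ n` times the Boltzmann weight of the `n` points. It follows by
induction on the number of terms. Retaining the Boltzmann weight in the bound is what produces the
interacting integrals `g(k)` in `Ψ`.

In finite volume, `corr` convolved with the partition function gives the unnormalised correlations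
(`signedGasIntegral_eq_sum`). For one point, integrated over the region, this is `z Ξ' = Ξ ∫ ρ`
(`sum_lintegral_corr_mul`), so the integrated one-point series is a logarithmic derivative and
`exp_tsum_eq_tsum_of_logDeriv` produces the logarithm on the closed disc.

By positivity `corr` grows with the region (`corr_restrict_mono`). Hence the infinite-volume
coefficients dominate the averaged finite-volume ones, and their series at `r` sums to at most `μ`:
this gives the bounds and the uniform convergence. Monotone convergence, translation invariance and
the van Hove condition give the limits of the coefficients (`tendsto_setLIntegral_corr`), and
dominated convergence transfers them to the pressures. -/

/-- A symmetric measurable kernel with values in `[0, 1]`. -/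
structure IsBoltzmannKernel {E : Type*} [MeasurableSpace E] (e : E → E → ℝ) : Prop where
  measurable : Measurable (Function.uncurry e)
  nonneg : ∀ x y, 0 ≤ e x y
  le_one : ∀ x y, e x y ≤ 1
  symm : ∀ x y, e x y = e y x

/-- The product of `e (x i) (x j)` over all unordered pairs of distinct indices. -/
noncomputable def pairWeight {E ι : Type*} [Fintype ι] (e : E → E → ℝ) (x : ι → E) : ℝ :=
  open Classical in Real.sqrt (∏ i, ∏ j, if i = j then 1 else e (x i) (x j))

/-! ### Boltzmann weights of finite families of points -/

section PairWeight

variable {E : Type*} [MeasurableSpace E] {e : E → E → ℝ} {ι κ : Type*} [Fintype ι] [Fintype κ]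

omit [MeasurableSpace E] in
lemma pairWeight_nonneg (x : ι → E) : 0 ≤ pairWeight e x := Real.sqrt_nonneg _

omit [MeasurableSpace E] in
-- The square root of the product over ordered pairs needs no order on the index type, so
-- relabelling is a mere change of variables in the product. `prod_prod_Ioi_eq_pairWeight` recovers
-- the product over `i < j`.
lemma pairWeight_comp_equiv (σ : κ ≃ ι) (x : ι → E) : pairWeight e (x ∘ σ) = pairWeight e x := by
  classical
  unfold pairWeight
  congr 1
  refine Fintype.prod_equiv σ _ _ fun i => Fintype.prod_equiv σ _ _ fun j => ?_
  simp [σ.injective.eq_iff]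

lemma IsBoltzmannKernel.prod_nonneg (he : IsBoltzmannKernel e) (x : E) (y : ι → E) :
    0 ≤ ∏ i, e x (y i) := Finset.prod_nonneg fun _ _ => he.nonneg _ _

lemma IsBoltzmannKernel.prod_le_one (he : IsBoltzmannKernel e) (x : E) (y : ι → E) :
    ∏ i, e x (y i) ≤ 1 := Finset.prod_le_one (fun _ _ => he.nonneg _ _) fun _ _ => he.le_one _ _

lemma IsBoltzmannKernel.prod_one_sub_nonneg (he : IsBoltzmannKernel e) (x : E) (y : ι → E) :
    0 ≤ ∏ i, (1 - e x (y i)) := Finset.prod_nonneg fun _ _ => sub_nonneg.2 (he.le_one _ _)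

lemma IsBoltzmannKernel.prod_one_sub_le_one (he : IsBoltzmannKernel e) (x : E) (y : ι → E) :
    ∏ i, (1 - e x (y i)) ≤ 1 :=
  Finset.prod_le_one (fun _ _ => sub_nonneg.2 (he.le_one _ _)) fun _ _ => by
    linarith [he.nonneg x (y ‹_›)]

lemma IsBoltzmannKernel.pairWeight_le_one (he : IsBoltzmannKernel e) (x : ι → E) :
    pairWeight e x ≤ 1 := by
  classical
  refine Real.sqrt_le_one.2 (Finset.prod_le_one (fun i _ => Finset.prod_nonneg fun j _ => ?_)
    fun i _ => Finset.prod_le_one (fun j _ => ?_) fun j _ => ?_) <;> split_ifs <;>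
  simp [he.nonneg, he.le_one]

lemma IsBoltzmannKernel.measurable_comp {α : Type*} [MeasurableSpace α]
    (he : IsBoltzmannKernel e) {f g : α → E} (hf : Measurable f) (hg : Measurable g) :
    Measurable fun a => e (f a) (g a) := he.measurable.comp (hf.prodMk hg)

lemma IsBoltzmannKernel.measurable_pairWeight (he : IsBoltzmannKernel e) :
    Measurable (pairWeight e : (ι → E) → ℝ) := by
  classical
  unfold pairWeight
  refine Measurable.sqrt (Finset.measurable_fun_prod _ fun i _ =>
    Finset.measurable_fun_prod _ fun j _ => ?_)
  split_ifs
  · exact measurable_const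
  · exact he.measurable_comp (measurable_pi_apply i) (measurable_pi_apply j)

open Classical in
lemma IsBoltzmannKernel.pairProduct_nonneg (he : IsBoltzmannKernel e) (x : ι → E) :
    0 ≤ ∏ i, ∏ j, (if i = j then 1 else e (x i) (x j)) :=
  Finset.prod_nonneg fun i _ => Finset.prod_nonneg fun j _ => by
    split_ifs <;> simp [he.nonneg]

lemma IsBoltzmannKernel.pairWeight_sumElim (he : IsBoltzmannKernel e) (x : ι → E) (y : κ → E) :
    pairWeight e (Sum.elim x y) =
      pairWeight e x * pairWeight e y * ∏ i, ∏ j, e (x i) (y j) := by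
  classical
  have h0 : 0 ≤ ∏ i, ∏ j, e (x i) (y j) := Finset.prod_nonneg fun i _ => he.prod_nonneg _ _
  have h1 : 0 ≤ ∏ i, ∏ j, (if i = j then 1 else e (x i) (x j)) := he.pairProduct_nonneg x
  have h2 : 0 ≤ ∏ i, ∏ j, (if i = j then 1 else e (y i) (y j)) := he.pairProduct_nonneg y
  have h3 : ∏ j, ∏ i, e (y j) (x i) = ∏ i, ∏ j, e (x i) (y j) := by
    rw [Finset.prod_comm]; simp only [he.symm (y _) (x _)]
  unfold pairWeight
  rw [← Real.sqrt_mul h1, ← Real.sqrt_sq h0, ← Real.sqrt_mul (mul_nonneg h1 h2)]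
  congr 1
  simp only [Fintype.prod_sum_type, Sum.elim_inl, Sum.elim_inr, Sum.inl.injEq, Sum.inr.injEq,
    reduceCtorEq, if_false, Finset.prod_mul_distrib, h3]
  ring

lemma IsBoltzmannKernel.pairWeight_cons (he : IsBoltzmannKernel e) {n : ℕ} (a : E)
    (x : Fin n → E) :
    pairWeight e (Fin.cons a x : Fin (n + 1) → E) = (∏ i, e a (x i)) * pairWeight e x := by
  classical
  have h0 := he.prod_nonneg a x
  unfold pairWeight
  rw [← Real.sqrt_sq h0, ← Real.sqrt_mul (sq_nonneg _)]
  congr 1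
  simp only [Fin.prod_univ_succ, Fin.cons_zero, Fin.cons_succ, Fin.succ_inj, Fin.succ_ne_zero,
    (Fin.succ_ne_zero _).symm, if_true, if_false, Finset.prod_mul_distrib, he.symm (x _) a]
  ring_nf

lemma IsBoltzmannKernel.pairWeight_append (he : IsBoltzmannKernel e) {n k : ℕ} (x : Fin n → E)
    (y : Fin k → E) :
    pairWeight e (Fin.append x y) = pairWeight e x * pairWeight e y * ∏ i, ∏ j, e (x i) (y j) := by
  rw [← he.pairWeight_sumElim, ← pairWeight_comp_equiv finSumFinEquiv]
  congr 1
  ext i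
  rcases i with i | i <;> simp

lemma IsBoltzmannKernel.pairWeight_sumElim_cons (he : IsBoltzmannKernel e) {n : ℕ} (a : E)
    (x : Fin n → E) (y : ι → E) :
    pairWeight e (Sum.elim (Fin.cons a x : Fin (n + 1) → E) y) =
      (∏ i, e a (x i)) * (∏ j, e a (y j)) * pairWeight e (Sum.elim x y) := by
  simp only [he.pairWeight_sumElim, he.pairWeight_cons, Fin.prod_univ_succ, Fin.cons_zero,
    Fin.cons_succ]
  ring

lemma IsBoltzmannKernel.pairWeight_sumElim_append (he : IsBoltzmannKernel e) {n k l : ℕ}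
    (σ : Fin k ⊕ Fin l ≃ ι) (x : Fin n → E) (y : Fin k → E) (w : Fin l → E) :
    pairWeight e (Sum.elim (Fin.append x y) w) =
      pairWeight e (Sum.elim x (Sum.elim y w ∘ σ.symm)) := by
  rw [he.pairWeight_sumElim x, pairWeight_comp_equiv]
  have h : ∀ i, ∏ j, e (x i) ((Sum.elim y w ∘ σ.symm) j) =
      (∏ j, e (x i) (y j)) * ∏ j, e (x i) (w j) := fun i => by
    rw [← σ.prod_comp]; simp
  simp only [h, he.pairWeight_sumElim, he.pairWeight_append, Fin.prod_univ_add,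
    Fin.append_left, Fin.append_right, Finset.prod_mul_distrib]
  ring

omit [MeasurableSpace E] in
lemma pairWeight_of_isEmpty [IsEmpty ι] (x : ι → E) : pairWeight e x = 1 := by
  simp [pairWeight]

omit [MeasurableSpace E] in
lemma pairWeight_of_unique [Unique ι] (x : ι → E) : pairWeight e x = 1 := by
  simp [pairWeight, Subsingleton.elim _ (default : ι)]

end PairWeight

/-! ### Fubini for a split index set, and integrability -/

section Split

variable {E : Type*} [MeasurableSpace E] {ι κ τ : Type*} [Fintype ι] [Fintype κ] [Fintype τ]

lemma measurePreserving_sumElim_comp (ν : Measure E) [SigmaFinite ν] (σ : ι ⊕ κ ≃ τ) :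
    MeasurePreserving (fun p : (ι → E) × (κ → E) => Sum.elim p.1 p.2 ∘ σ.symm)
      ((Measure.pi fun _ => ν).prod (Measure.pi fun _ => ν)) (Measure.pi fun _ : τ => ν) := by
  have h := (measurePreserving_piCongrLeft (fun _ : τ => ν) σ).comp
    (measurePreserving_sumPiEquivProdPi_symm (fun _ : ι ⊕ κ => ν))
  convert h using 1
  ext p t
  obtain ⟨s, rfl⟩ := σ.surjective t
  rcases s with s | s <;> simp [MeasurableEquiv.piCongrLeft, MeasurableEquiv.sumPiEquivProdPi, Equiv.sumPiEquivProdPi]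

lemma integral_pi_eq_integral_sumElim (ν : Measure E) [IsFiniteMeasure ν] (σ : ι ⊕ κ ≃ τ)
    {F : (τ → E) → ℝ} (hF : Integrable F (Measure.pi fun _ => ν)) :
    ∫ y, F y ∂(Measure.pi fun _ => ν) =
      ∫ y, ∫ w, F (Sum.elim y w ∘ σ.symm) ∂(Measure.pi fun _ : κ => ν)
        ∂(Measure.pi fun _ : ι => ν) := by
  have h := measurePreserving_sumElim_comp ν σ
  have h' := h.integrable_comp_of_integrable hF
  rw [← h.map_eq, integral_map h.measurable.aemeasurable (by rw [h.map_eq]; exact hF.1)]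
  exact integral_prod _ h'

end Split

/-- The coefficient of `z ^ m` in the unnormalised correlation function at the points `x`. -/
noncomputable def gasIntegral {E ι : Type*} [MeasurableSpace E] [Fintype ι] (e : E → E → ℝ)
    (ν : Measure E) (m : ℕ) (x : ι → E) : ℝ :=
  (m.factorial : ℝ)⁻¹ * ∫ y : Fin m → E, pairWeight e (Sum.elim x y) ∂(Measure.pi fun _ => ν)

section Integrability

variable {E : Type*} [MeasurableSpace E] {e : E → E → ℝ} {ι κ : Type*} [Fintype ι] [Fintype κ]
  {ν : Measure E} [IsFiniteMeasure ν]

lemma integrable_of_bounds {α : Type*} [MeasurableSpace α] {P : Measure α} [IsFiniteMeasure P]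
    {F : α → ℝ} (hF : Measurable F) {B : ℝ} (h0 : ∀ a, 0 ≤ F a) (h1 : ∀ a, F a ≤ B) :
    Integrable F P :=
  Integrable.of_bound hF.aestronglyMeasurable B (ae_of_all _ fun a => by
    rw [Real.norm_of_nonneg (h0 a)]; exact h1 a)

omit [Fintype ι] [Fintype κ] in
lemma measurable_sumElim {α : Type*} [MeasurableSpace α] {f : α → ι → E} {g : α → κ → E}
    (hf : Measurable f) (hg : Measurable g) : Measurable fun a => Sum.elim (f a) (g a) := by
  refine measurable_pi_iff.2 fun s => ?_
  rcases s with s | s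
  · exact (measurable_pi_apply s).comp hf
  · exact (measurable_pi_apply s).comp hg

lemma measurable_fin_append {α : Type*} [MeasurableSpace α] {n k : ℕ} {f : α → Fin n → E}
    {g : α → Fin k → E} (hf : Measurable f) (hg : Measurable g) :
    Measurable fun a => Fin.append (f a) (g a) := by
  refine measurable_pi_iff.2 fun s => ?_
  refine Fin.addCases (fun s => ?_) (fun s => ?_) s
  · simpa [Function.comp_def] using (measurable_pi_apply s).comp hf
  · simpa [Function.comp_def] using (measurable_pi_apply s).comp hg

lemma IsBoltzmannKernel.integrable_mul_pairWeight (he : IsBoltzmannKernel e) (x : ι → E) (a : E)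
    (S : Finset κ) :
    Integrable (fun y : κ → E => (∏ j ∈ S, (1 - e a (y j))) * pairWeight e (Sum.elim x y))
      (Measure.pi fun _ => ν) := by
  have h0 : ∀ y : κ → E, 0 ≤ ∏ j ∈ S, (1 - e a (y j)) := fun y =>
    Finset.prod_nonneg fun _ _ => sub_nonneg.2 (he.le_one _ _)
  refine integrable_of_bounds ?_ (B := 1) (fun y => mul_nonneg (h0 y) (pairWeight_nonneg _))
    fun y => mul_le_one₀ (Finset.prod_le_one (fun _ _ => sub_nonneg.2 (he.le_one _ _))
      fun _ _ => sub_le_self _ (he.nonneg _ _)) (pairWeight_nonneg _) (he.pairWeight_le_one _)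
  refine Measurable.mul (Finset.measurable_fun_prod _ fun i _ => measurable_const.sub
    (he.measurable_comp measurable_const (measurable_pi_apply i))) ?_
  exact he.measurable_pairWeight.comp (measurable_sumElim measurable_const measurable_id)

end Integrability

/-! ### Kirkwood-Salsburg equations -/

section KirkwoodSalsburg

variable {E : Type*} [MeasurableSpace E] {e : E → E → ℝ} {ν : Measure E} [IsFiniteMeasure ν]

/-- The variables indexed by `S` become points of a correlation function and the remaining ones are
integrated out. Since the variables are interchangeable, only the size of `S` matters. -/
lemma IsBoltzmannKernel.integral_prod_finset_mul_pairWeight (he : IsBoltzmannKernel e) {n m : ℕ}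
    (a : E) (x : Fin n → E) (S : Finset (Fin m)) :
    ∫ y : Fin m → E, (∏ j ∈ S, (1 - e a (y j))) * pairWeight e (Sum.elim x y)
        ∂(Measure.pi fun _ => ν) =
      ((m - S.card).factorial : ℝ) * ∫ y : Fin S.card → E, (∏ j, (1 - e a (y j))) *
        gasIntegral e ν (m - S.card) (Fin.append x y) ∂(Measure.pi fun _ => ν) := by
  classical
  have hc : Sᶜ.card = m - S.card := by simp [Finset.card_compl]
  set σ := finSumEquivOfFinset rfl hc
  rw [integral_pi_eq_integral_sumElim ν σ (he.integrable_mul_pairWeight x a S),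
    ← integral_const_mul]
  refine integral_congr_ae (ae_of_all _ fun y => ?_)
  have hS : ∀ w : Fin (m - S.card) → E,
      ∏ j ∈ S, (1 - e a ((Sum.elim y w ∘ σ.symm) j)) = ∏ j, (1 - e a (y j)) := fun w => by
    refine (Finset.prod_bij (fun j _ => σ (Sum.inl j)) (fun j _ => ?_) (fun i _ j _ h => ?_)
      (fun j hj => ?_) fun j _ => ?_).symm
    · simp [σ, finSumEquivOfFinset_inl]
    · simpa using h
    · obtain ⟨s, rfl⟩ := σ.surjective j
      rcases s with s | s
      · exact ⟨s, by simp, rfl⟩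
      · have : σ (Sum.inr s) ∈ Sᶜ := by
          simp only [σ, finSumEquivOfFinset_inr]
          exact Finset.orderEmbOfFin_mem _ _ _
        simp [hj] at this
    · simp
  have hfac : ((m - S.card).factorial : ℝ) ≠ 0 := by positivity
  simp only [hS, integral_const_mul, gasIntegral, ← he.pairWeight_sumElim_append σ]
  field_simp

/-- The Kirkwood-Salsburg equations, order by order in the fugacity. -/
lemma IsBoltzmannKernel.gasIntegral_cons (he : IsBoltzmannKernel e) {n : ℕ} (m : ℕ)
    (a : E) (x : Fin n → E) :
    gasIntegral e ν m (Fin.cons a x : Fin (n + 1) → E) =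
      (∏ i, e a (x i)) * ∑ k ∈ Finset.range (m + 1), (-1) ^ k * (k.factorial : ℝ)⁻¹ *
        ∫ y : Fin k → E, (∏ j, (1 - e a (y j))) * gasIntegral e ν (m - k) (Fin.append x y)
          ∂(Measure.pi fun _ => ν) := by
  classical
  have hexp : ∀ y : Fin m → E, pairWeight e (Sum.elim (Fin.cons a x : Fin (n + 1) → E) y) =
      (∏ i, e a (x i)) * ∑ S ∈ (Finset.univ : Finset (Fin m)).powerset, (-1) ^ S.card *
        ((∏ j ∈ S, (1 - e a (y j))) * pairWeight e (Sum.elim x y)) := fun y => by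
    -- Each factor is written as `1 - (1 - e)` and the product is expanded over subsets.
    have h1 : ∏ j, e a (y j) = ∑ S ∈ (Finset.univ : Finset (Fin m)).powerset,
        (-1) ^ S.card * ∏ j ∈ S, (1 - e a (y j)) := by
      have := Finset.prod_add (fun j => -(1 - e a (y j))) (fun _ => 1) Finset.univ
      simp only [neg_sub, sub_add_cancel, Finset.prod_const_one, mul_one] at this
      rw [this]
      refine Finset.sum_congr rfl fun S _ => ?_
      rw [← Finset.prod_const, ← Finset.prod_mul_distrib]
      simp
    rw [he.pairWeight_sumElim_cons, h1, mul_assoc, Finset.sum_mul]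
    simp only [mul_assoc]
  set J : ℕ → ℝ := fun k => ∫ y : Fin k → E, (∏ j, (1 - e a (y j))) *
    gasIntegral e ν (m - k) (Fin.append x y) ∂(Measure.pi fun _ => ν) with hJ
  unfold gasIntegral
  simp only [hexp]
  rw [integral_const_mul, integral_finsetSum _ fun S _ =>
    (he.integrable_mul_pairWeight x a S).const_mul _]
  simp only [integral_const_mul, he.integral_prod_finset_mul_pairWeight]
  -- Subsets of equal size contribute equally; the binomial coefficient times `(m - k)! / m!` leaves
  -- `1 / k!`.
  rw [Finset.sum_powerset_apply_card (fun k => (-1) ^ k * (((m - k).factorial : ℝ) * J k)),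
    mul_left_comm, Finset.mul_sum]
  congr 1
  simp only [Finset.card_univ, Fintype.card_fin]
  refine Finset.sum_congr rfl fun k hk => ?_
  rw [nsmul_eq_mul, Nat.cast_choose ℝ (Nat.lt_succ_iff.1 (Finset.mem_range.1 hk))]
  have h1 : (m.factorial : ℝ) ≠ 0 := by positivity
  have h2 : (k.factorial : ℝ) ≠ 0 := by positivity
  have h3 : ((m - k).factorial : ℝ) ≠ 0 := by positivity
  change _ = (-1) ^ k * (k.factorial : ℝ)⁻¹ * J k
  field_simp

end KirkwoodSalsburg

/-! ### The positive recursion and its main estimate -/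

/-- The absolute value of the coefficient of `z ^ M` in the `n`-point correlation function of the
gas with Boltzmann kernel `e` and reference measure `ν`, defined through the Kirkwood-Salsburg
recursion. -/
noncomputable def corr {E : Type*} [MeasurableSpace E] (e : E → E → ℝ) (ν : Measure E) :
    ℕ → (n : ℕ) → (Fin n → E) → ℝ≥0∞
  | 0, 0, _ => 1
  | 0, _ + 1, _ => 0
  | _ + 1, 0, _ => 0
  | M + 1, n + 1, x => ENNReal.ofReal (∏ i, e (x 0) (Fin.tail x i)) *
      ∑ k ∈ Finset.range (M + 1), (k.factorial : ℝ≥0∞)⁻¹ *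
        ∫⁻ y : Fin k → E, ENNReal.ofReal (∏ j, (1 - e (x 0) (y j))) *
          corr e ν M (n + k) (Fin.append (Fin.tail x) y) ∂(Measure.pi fun _ => ν)

section Corr

variable {E : Type*} [MeasurableSpace E] {e : E → E → ℝ} {ν : Measure E}

lemma corr_zero_zero (x : Fin 0 → E) : corr e ν 0 0 x = 1 := by rw [corr]

lemma corr_zero_succ {n : ℕ} (x : Fin (n + 1) → E) : corr e ν 0 (n + 1) x = 0 := by rw [corr]

lemma corr_succ_zero {M : ℕ} (x : Fin 0 → E) : corr e ν (M + 1) 0 x = 0 := by rw [corr]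

lemma corr_succ_succ {M n : ℕ} (x : Fin (n + 1) → E) :
    corr e ν (M + 1) (n + 1) x = ENNReal.ofReal (∏ i, e (x 0) (Fin.tail x i)) *
      ∑ k ∈ Finset.range (M + 1), (k.factorial : ℝ≥0∞)⁻¹ *
        ∫⁻ y : Fin k → E, ENNReal.ofReal (∏ j, (1 - e (x 0) (y j))) *
          corr e ν M (n + k) (Fin.append (Fin.tail x) y) ∂(Measure.pi fun _ => ν) := by
  rw [corr]

/-- Each step of the recursion uses one power of `z` and removes at most one point, so `n` points
need at least `n` powers. -/
lemma corr_eq_zero_of_lt {M n : ℕ} (h : M < n) (x : Fin n → E) : corr e ν M n x = 0 := by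
  induction M generalizing n with
  | zero =>
    obtain ⟨n, rfl⟩ : ∃ n', n = n' + 1 := ⟨n - 1, by omega⟩
    exact corr_zero_succ x
  | succ M ih =>
    obtain ⟨n, rfl⟩ : ∃ n', n = n' + 1 := ⟨n - 1, by omega⟩
    have h0 : ∀ k (z : Fin (n + k) → E), corr e ν M (n + k) z = 0 := fun k z => ih (by omega) z
    simp [corr_succ_succ, h0]

lemma IsBoltzmannKernel.measurable_corr_integrand [SigmaFinite ν] (he : IsBoltzmannKernel e)
    {M n k : ℕ} (h : Measurable (corr e ν M (n + k))) :
    Measurable fun p : (Fin (n + 1) → E) × (Fin k → E) =>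
      ENNReal.ofReal (∏ j, (1 - e (p.1 0) (p.2 j))) *
        corr e ν M (n + k) (Fin.append (Fin.tail p.1) p.2) := by
  have h1 : ∀ i : Fin (n + 1), Measurable fun p : (Fin (n + 1) → E) × (Fin k → E) => p.1 i :=
    fun i => (measurable_pi_apply i).comp measurable_fst
  refine Measurable.mul (Measurable.ennreal_ofReal (Finset.measurable_fun_prod _ fun j _ =>
    measurable_const.sub (he.measurable_comp (h1 0)
      ((measurable_pi_apply j).comp measurable_snd)))) (h.comp (measurable_fin_append
        (measurable_pi_iff.2 fun i => h1 i.succ) measurable_snd))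

lemma IsBoltzmannKernel.measurable_corr [SigmaFinite ν] (he : IsBoltzmannKernel e) (M n : ℕ) :
    Measurable (corr e ν M n) := by
  induction M generalizing n with
  | zero =>
    rcases n with _ | n
    · exact (funext fun x => corr_zero_zero x : corr e ν _ _ = fun _ => _) ▸ measurable_const
    · exact (funext fun x => corr_zero_succ x : corr e ν _ _ = fun _ => _) ▸ measurable_const
  | succ M ih =>
    rcases n with _ | n
    · exact (funext fun x => corr_succ_zero x : corr e ν _ _ = fun _ => _) ▸ measurable_const
    · rw [show corr e ν (M + 1) (n + 1) = _ from funext fun x => corr_succ_succ x]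
      refine Measurable.mul (Measurable.ennreal_ofReal (Finset.measurable_fun_prod _ fun i _ =>
        he.measurable_comp (measurable_pi_apply 0) (measurable_pi_apply i.succ))) ?_
      refine Finset.measurable_fun_sum _ fun k _ => Measurable.const_mul ?_ _
      exact (he.measurable_corr_integrand (ih (n + k))).lintegral_prod_right'

lemma IsBoltzmannKernel.measurable_corr_integrand_right [SigmaFinite ν]
    (he : IsBoltzmannKernel e) (M k : ℕ) {n : ℕ} (x : Fin (n + 1) → E) :
    Measurable fun y : Fin k → E => ENNReal.ofReal (∏ j, (1 - e (x 0) (y j))) *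
      corr e ν M (n + k) (Fin.append (Fin.tail x) y) := by
  have h := (he.measurable_corr_integrand (n := n) (k := k) (he.measurable_corr (ν := ν) M (n + k)))
  exact h.of_uncurry_left (f := fun (x : Fin (n + 1) → E) (y : Fin k → E) =>
    ENNReal.ofReal (∏ j, (1 - e (x 0) (y j))) *
      corr e ν M (n + k) (Fin.append (Fin.tail x) y))

/-- `(r, μ)` is admissible if `r Ψ(μ) ≤ μ`, where `Ψ` is the vertex sum. -/
def IsAdmissible (e : E → E → ℝ) (ν : Measure E) (r μ : ℝ≥0∞) : Prop :=
  ∀ (K : ℕ) (a : E), r * ∑ k ∈ Finset.range K, (k.factorial : ℝ≥0∞)⁻¹ * (μ ^ k *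
    ∫⁻ y : Fin k → E, ENNReal.ofReal (∏ j, (1 - e a (y j))) * ENNReal.ofReal (pairWeight e y)
      ∂(Measure.pi fun _ => ν)) ≤ μ

/-- Removing the first point and inserting the bound for `n + k` points, the weight of the joint
family factors into the weight of the old points, that of the new ones and a cross term at most `1`.
The sum over `k` is then a partial sum of `Ψ(μ)`, and admissibility replaces `r Ψ(μ)` by the missing
factor `μ`. The factors between the removed point and the others restore the full weight. -/
lemma IsBoltzmannKernel.sum_corr_le [SigmaFinite ν] (he : IsBoltzmannKernel e) {r μ : ℝ≥0∞}
    (hr : IsAdmissible e ν r μ) (hμ : μ ≠ ⊤) (N : ℕ) {n : ℕ} (x : Fin n → E) :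
    ∑ M ∈ Finset.range N, r ^ M * corr e ν M n x ≤
      μ ^ n * ENNReal.ofReal (pairWeight e x) := by
  induction N generalizing n with
  | zero => simp
  | succ N ih =>
    rcases n with _ | n
    · rw [Finset.sum_range_succ']
      simp [corr_succ_zero, corr_zero_zero, pairWeight_of_isEmpty]
    set a := x 0
    set t := Fin.tail x
    have hx : x = Fin.cons a t := (Fin.cons_self_tail x).symm
    set A := ENNReal.ofReal (∏ i, e a (t i)) with hA
    have hint : ∀ k, ∑ M ∈ Finset.range N, r ^ M *
        ∫⁻ y : Fin k → E, ENNReal.ofReal (∏ j, (1 - e a (y j))) *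
          corr e ν M (n + k) (Fin.append t y) ∂(Measure.pi fun _ => ν) ≤
        μ ^ n * ENNReal.ofReal (pairWeight e t) * (μ ^ k * ∫⁻ y : Fin k → E,
          ENNReal.ofReal (∏ j, (1 - e a (y j))) * ENNReal.ofReal (pairWeight e y)
            ∂(Measure.pi fun _ => ν)) := fun k => by
      simp only [← lintegral_const_mul _ (he.measurable_corr_integrand_right _ k x), a, t]
      rw [← lintegral_finsetSum _ fun M _ =>
        (he.measurable_corr_integrand_right M k x).const_mul _, ← mul_assoc,
        ← lintegral_const_mul' _ _ (by finiteness)]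
      refine lintegral_mono fun y => ?_
      simp only [mul_left_comm _ (ENNReal.ofReal (∏ j, (1 - e (x 0) (y j)))), ← Finset.mul_sum]
      gcongr
      refine (ih _).trans ?_
      rw [he.pairWeight_append, pow_add, ENNReal.ofReal_mul (by
        exact mul_nonneg (pairWeight_nonneg _) (pairWeight_nonneg _)),
        ENNReal.ofReal_mul (pairWeight_nonneg _)]
      -- Repulsiveness: the interaction between old and new points is discarded.
      have : ENNReal.ofReal (∏ i, ∏ j, e (Fin.tail x i) (y j)) ≤ 1 :=
        ENNReal.ofReal_le_one.2 (Finset.prod_le_one (fun _ _ => he.prod_nonneg _ _)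
          fun _ _ => he.prod_le_one _ _)
      calc _ ≤ μ ^ n * μ ^ k * (ENNReal.ofReal (pairWeight e (Fin.tail x)) *
              ENNReal.ofReal (pairWeight e y) * 1) := by gcongr
        _ = _ := by ring
    rw [Finset.sum_range_succ', corr_zero_succ, mul_zero, add_zero]
    calc ∑ M ∈ Finset.range N, r ^ (M + 1) * corr e ν (M + 1) (n + 1) x
        ≤ ∑ M ∈ Finset.range N, r ^ (M + 1) * (A * ∑ k ∈ Finset.range N,
            (k.factorial : ℝ≥0∞)⁻¹ * ∫⁻ y : Fin k → E, ENNReal.ofReal (∏ j, (1 - e a (y j))) *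
              corr e ν M (n + k) (Fin.append t y) ∂(Measure.pi fun _ => ν)) := by
          -- The range of `k` is enlarged to one independent of `M`, so that the two sums can be
          -- exchanged.
          refine Finset.sum_le_sum fun M hM => ?_
          rw [corr_succ_succ]
          gcongr
          exact Finset.mem_range.1 hM
      _ = A * (r * ∑ k ∈ Finset.range N, (k.factorial : ℝ≥0∞)⁻¹ * ∑ M ∈ Finset.range N, r ^ M *
            ∫⁻ y : Fin k → E, ENNReal.ofReal (∏ j, (1 - e a (y j))) *
              corr e ν M (n + k) (Fin.append t y) ∂(Measure.pi fun _ => ν)) := by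
          simp only [Finset.mul_sum]
          rw [Finset.sum_comm]
          refine Finset.sum_congr rfl fun k _ => Finset.sum_congr rfl fun M _ => ?_
          ring
      _ ≤ A * (r * ∑ k ∈ Finset.range N, (k.factorial : ℝ≥0∞)⁻¹ *
            (μ ^ n * ENNReal.ofReal (pairWeight e t) * (μ ^ k * ∫⁻ y : Fin k → E,
              ENNReal.ofReal (∏ j, (1 - e a (y j))) * ENNReal.ofReal (pairWeight e y)
                ∂(Measure.pi fun _ => ν)))) := by
          gcongr with k _
          exact hint k
      _ = A * (μ ^ n * ENNReal.ofReal (pairWeight e t)) * (r * ∑ k ∈ Finset.range N,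
            (k.factorial : ℝ≥0∞)⁻¹ * (μ ^ k * ∫⁻ y : Fin k → E,
              ENNReal.ofReal (∏ j, (1 - e a (y j))) * ENNReal.ofReal (pairWeight e y)
                ∂(Measure.pi fun _ => ν))) := by
          simp only [Finset.mul_sum]
          refine Finset.sum_congr rfl fun k _ => ?_
          ring
      _ ≤ A * (μ ^ n * ENNReal.ofReal (pairWeight e t)) * μ := by
          gcongr
          exact hr N a
      _ = μ ^ (n + 1) * ENNReal.ofReal (pairWeight e x) := by
          rw [hx, he.pairWeight_cons, ENNReal.ofReal_mul (he.prod_nonneg _ _), ← hA]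
          ring

/-- A single term of the nonnegative sum. This crude pointwise bound supplies the finiteness and
integrability needed to pass to real integrals. -/
lemma IsBoltzmannKernel.corr_le [SigmaFinite ν] (he : IsBoltzmannKernel e) {r μ : ℝ≥0∞}
    (hr : IsAdmissible e ν r μ) (hr0 : r ≠ 0) (hr1 : r ≠ ⊤)
    (hμ : μ ≠ ⊤) (M : ℕ) {n : ℕ} (x : Fin n → E) :
    corr e ν M n x ≤ (r ^ M)⁻¹ * μ ^ n := by
  have h := (Finset.single_le_sum (f := fun M => r ^ M * corr e ν M n x) (fun _ _ => zero_le)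
    (Finset.self_mem_range_succ M)).trans ((he.sum_corr_le hr hμ (M + 1) x).trans
      (mul_le_of_le_one_right' (ENNReal.ofReal_le_one.2 (he.pairWeight_le_one x))))
  rw [mul_comm, ← div_eq_mul_inv]
  exact (ENNReal.le_div_iff_mul_le (.inl (pow_ne_zero _ hr0)) (.inl (by finiteness))).2
    (by rwa [mul_comm])

end Corr

/-! ### Factorization through the partition function -/

/-- The coefficients `(-1) ^ (M - n) * gasIntegral e ν (M - n) x` of `z ^ M` in the unnormalised
`n`-point correlation function at fugacity `-z`, up to the global sign. -/
noncomputable def signedGasIntegral {E : Type*} [MeasurableSpace E] (e : E → E → ℝ)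
    (ν : Measure E) (M n : ℕ) (x : Fin n → E) : ℝ :=
  if n ≤ M then (-1) ^ (M - n) * gasIntegral e ν (M - n) x else 0

section Factorization

variable {E : Type*} [MeasurableSpace E] {e : E → E → ℝ} {ν : Measure E}

/-- Adding `k` points lowers the order of the gas integral by `k`, so the built-in sign changes by
`(-1) ^ k` and cancels the Kirkwood-Salsburg sign. The result is the recursion that defines `corr`.
-/
lemma IsBoltzmannKernel.signedGasIntegral_succ_succ [IsFiniteMeasure ν]
    (he : IsBoltzmannKernel e) (M : ℕ) {n : ℕ} (x : Fin (n + 1) → E) :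
    signedGasIntegral e ν (M + 1) (n + 1) x = (∏ i, e (x 0) (Fin.tail x i)) *
      ∑ k ∈ Finset.range (M + 1), (k.factorial : ℝ)⁻¹ *
        ∫ y : Fin k → E, (∏ j, (1 - e (x 0) (y j))) *
          signedGasIntegral e ν M (n + k) (Fin.append (Fin.tail x) y)
            ∂(Measure.pi fun _ => ν) := by
  by_cases hn : n ≤ M
  · have hx : x = Fin.cons (x 0) (Fin.tail x) := (Fin.cons_self_tail x).symm
    rw [signedGasIntegral, if_pos (by omega), Nat.add_sub_add_right]
    conv_lhs => rw [hx, he.gasIntegral_cons, mul_left_comm, Finset.mul_sum]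
    congr 1
    refine Finset.sum_subset_zero_on_sdiff (Finset.range_mono (by omega)) (fun k hk => ?_)
      fun k hk => ?_
    · simp only [Finset.mem_sdiff, Finset.mem_range] at hk
      simp [signedGasIntegral, show ¬ n + k ≤ M by omega]
    · rw [Finset.mem_range] at hk
      obtain ⟨l, rfl⟩ : ∃ l, M = n + k + l := ⟨M - (n + k), by omega⟩
      simp only [signedGasIntegral, show n + k ≤ n + k + l by omega, if_true,
        show n + k + l - (n + k) = l by omega, show n + k + l - n = k + l by omega,
        show k + l - k = l by omega]
      simp only [mul_left_comm _ ((-1 : ℝ) ^ l), integral_const_mul, pow_add]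
      have : ((-1 : ℝ) ^ k) * (-1) ^ k = 1 := by rw [← mul_pow]; simp
      linear_combination ((-1 : ℝ) ^ l * (k.factorial : ℝ)⁻¹ *
        ∫ y : Fin k → E, (∏ j, (1 - e (x 0) (y j))) *
          gasIntegral e ν l (Fin.append (Fin.tail x) y) ∂(Measure.pi fun _ => ν)) * this
  · simp [signedGasIntegral, hn, show ∀ k, ¬ n + k ≤ M by omega]

/-- The free upper limit `K` lets the terms of a convolution, which have different orders `M`, share
one range of `k`; the extra terms vanish by `corr_eq_zero_of_lt`. -/
lemma IsBoltzmannKernel.toReal_corr_succ_succ [IsFiniteMeasure ν] (he : IsBoltzmannKernel e)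
    {B : ℕ → ℕ → ℝ≥0∞} (hB : ∀ M n, B M n ≠ ⊤) (h : ∀ M n x, corr e ν M n x ≤ B M n)
    {M K : ℕ} (hK : M + 1 ≤ K) {n : ℕ} (x : Fin (n + 1) → E) :
    (corr e ν (M + 1) (n + 1) x).toReal = (∏ i, e (x 0) (Fin.tail x i)) *
      ∑ k ∈ Finset.range K, (k.factorial : ℝ)⁻¹ *
        ∫ y : Fin k → E, (∏ j, (1 - e (x 0) (y j))) *
          (corr e ν M (n + k) (Fin.append (Fin.tail x) y)).toReal
            ∂(Measure.pi fun _ => ν) := by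
  have hlt : ∀ k (y : Fin k → E), ENNReal.ofReal (∏ j, (1 - e (x 0) (y j))) *
      corr e ν M (n + k) (Fin.append (Fin.tail x) y) ≤ B M (n + k) := fun k y =>
    (mul_le_of_le_one_left' (ENNReal.ofReal_le_one.2 (he.prod_one_sub_le_one _ _))).trans
      (h _ _ _)
  have hint : ∀ k, ∫⁻ y : Fin k → E, ENNReal.ofReal (∏ j, (1 - e (x 0) (y j))) *
      corr e ν M (n + k) (Fin.append (Fin.tail x) y) ∂(Measure.pi fun _ => ν) ≠ ⊤ := fun k => by
    refine ne_top_of_le_ne_top ?_ (lintegral_mono (hlt k))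
    rw [lintegral_const]
    exact ENNReal.mul_ne_top (hB _ _) (measure_ne_top _ _)
  rw [corr_succ_succ, ENNReal.toReal_mul, ENNReal.toReal_ofReal (he.prod_nonneg _ _),
    ENNReal.toReal_sum fun k _ => ENNReal.mul_ne_top (by simp [Nat.factorial_ne_zero]) (hint k)]
  congr 1
  refine Finset.sum_subset_zero_on_sdiff (Finset.range_mono hK) (fun k hk => ?_) fun k hk => ?_
  · simp only [Finset.mem_sdiff, Finset.mem_range] at hk
    have h0 : ∀ z : Fin (n + k) → E, corr e ν M (n + k) z = 0 := corr_eq_zero_of_lt (by omega)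
    simp [h0]
  · rw [ENNReal.toReal_mul, ENNReal.toReal_inv, ENNReal.toReal_natCast,
      ← integral_toReal (he.measurable_corr_integrand_right M k x).aemeasurable
        (ae_of_all _ fun y => (hlt k y).trans_lt (hB _ _).lt_top)]
    simp only [ENNReal.toReal_mul, ENNReal.toReal_ofReal (he.prod_one_sub_nonneg _ _)]

/-- The correlation functions are the quotients of the unnormalised ones by the partition
function. -/
lemma IsBoltzmannKernel.signedGasIntegral_eq_sum [IsFiniteMeasure ν] (he : IsBoltzmannKernel e)
    {B : ℕ → ℕ → ℝ≥0∞} (hB : ∀ M n, B M n ≠ ⊤) (h : ∀ M n x, corr e ν M n x ≤ B M n)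
    (M : ℕ) {n : ℕ} (x : Fin n → E) :
    signedGasIntegral e ν M n x = ∑ p ∈ Finset.HasAntidiagonal.antidiagonal M,
      (corr e ν p.1 n x).toReal * ((-1) ^ p.2 * gasIntegral e ν p.2 (Fin.elim0 : Fin 0 → E)) := by
  induction M generalizing n with
  | zero =>
    rcases n with _ | n
    · simp [signedGasIntegral, corr_zero_zero, Subsingleton.elim x Fin.elim0]
    · simp [signedGasIntegral, corr_zero_succ]
  | succ M ih =>
    rw [Finset.Nat.sum_antidiagonal_succ]
    rcases n with _ | n
    · simp [signedGasIntegral, corr_zero_zero, corr_succ_zero, Subsingleton.elim x Fin.elim0]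
    rw [corr_zero_succ, ENNReal.toReal_zero, zero_mul, zero_add, he.signedGasIntegral_succ_succ]
    -- Both sides obey the same linear recursion: convolution with the partition function does not
    -- involve the points, hence commutes with it.
    have hp : ∀ p ∈ Finset.HasAntidiagonal.antidiagonal M, (corr e ν (p.1 + 1) (n + 1) x).toReal *
        ((-1) ^ p.2 * gasIntegral e ν p.2 (Fin.elim0 : Fin 0 → E)) =
        (∏ i, e (x 0) (Fin.tail x i)) * ∑ k ∈ Finset.range (M + 1), (k.factorial : ℝ)⁻¹ *
          ∫ y : Fin k → E, (∏ j, (1 - e (x 0) (y j))) *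
            ((corr e ν p.1 (n + k) (Fin.append (Fin.tail x) y)).toReal *
              ((-1) ^ p.2 * gasIntegral e ν p.2 (Fin.elim0 : Fin 0 → E)))
              ∂(Measure.pi fun _ => ν) := fun p hp => by
      have : p.1 ≤ M := Finset.HasAntidiagonal.antidiagonal.fst_le hp
      rw [he.toReal_corr_succ_succ hB h (show p.1 + 1 ≤ M + 1 by omega), mul_assoc,
        Finset.sum_mul]
      simp only [← mul_assoc, integral_mul_const]
    rw [Finset.sum_congr rfl hp, ← Finset.mul_sum, Finset.sum_comm]
    congr 1
    refine Finset.sum_congr rfl fun k _ => ?_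
    rw [← Finset.mul_sum, ← integral_finsetSum]
    · simp only [ih, Finset.mul_sum]
    · intro p _
      simp only [← mul_assoc]
      refine Integrable.mul_const (Integrable.mul_const (integrable_of_bounds
        (B := (B p.1 (n + k)).toReal) ?_ (fun y => mul_nonneg (he.prod_one_sub_nonneg _ _)
          ENNReal.toReal_nonneg) fun y => ?_) _) _
      · have := (he.measurable_corr_integrand_right (ν := ν) p.1 k x).ennreal_toReal
        simpa only [ENNReal.toReal_mul,
          ENNReal.toReal_ofReal (he.prod_one_sub_nonneg _ _)] using this
      · exact (mul_le_of_le_one_left ENNReal.toReal_nonneg (he.prod_one_sub_le_one _ _)).trans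
          (ENNReal.toReal_mono (hB _ _) (h _ _ _))

end Factorization

/-! ### The one-point function as a logarithmic derivative -/

section OnePoint

variable {E : Type*} [MeasurableSpace E] {e : E → E → ℝ} {ν : Measure E} [IsFiniteMeasure ν]

omit [IsFiniteMeasure ν] in
lemma gasIntegral_elim0 (m : ℕ) : gasIntegral e ν m (Fin.elim0 : Fin 0 → E) =
    (m.factorial : ℝ)⁻¹ * ∫ y : Fin m → E, pairWeight e y ∂(Measure.pi fun _ => ν) := by
  unfold gasIntegral
  congr 2
  ext y
  exact pairWeight_comp_equiv (Equiv.emptySum (Fin 0) (Fin m)) y ▸ congrArg _ (by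
    ext i; rcases i with i | i
    · exact i.elim0
    · rfl)

lemma IsBoltzmannKernel.integral_gasIntegral_one (he : IsBoltzmannKernel e) (m : ℕ) :
    ∫ x, gasIntegral e ν m (fun _ : Fin 1 => x) ∂ν =
      (m + 1) * gasIntegral e ν (m + 1) (Fin.elim0 : Fin 0 → E) := by
  have hm : Integrable (pairWeight e : (Fin (m + 1) → E) → ℝ) (Measure.pi fun _ => ν) :=
    integrable_of_bounds he.measurable_pairWeight pairWeight_nonneg he.pairWeight_le_one
  -- Any bijection serves, because the weight is invariant under relabelling.
  have σ : Fin 1 ⊕ Fin m ≃ Fin (m + 1) := finSumFinEquiv.trans (finCongr (add_comm 1 m))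
  rw [gasIntegral_elim0, integral_pi_eq_integral_sumElim ν σ hm, Nat.factorial_succ]
  have h1 : ∫ y : Fin 1 → E, gasIntegral e ν m y ∂(Measure.pi fun _ => ν) =
      ∫ x, gasIntegral e ν m (fun _ : Fin 1 => x) ∂ν := by
    rw [← (measurePreserving_funUnique ν (Fin 1)).integral_comp'
      (g := fun x => gasIntegral e ν m (fun _ : Fin 1 => x))]
    have h2 : ∀ y : Fin 1 → E, (fun _ : Fin 1 => MeasurableEquiv.funUnique (Fin 1) E y) = y :=
      fun y => by ext i; simp [Subsingleton.elim i 0]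
    simp only [h2]
    congr!
  rw [← h1]
  simp only [gasIntegral, pairWeight_comp_equiv]
  rw [integral_const_mul]
  push_cast
  have : (m.factorial : ℝ) ≠ 0 := by positivity
  have : (m : ℝ) + 1 ≠ 0 := by positivity
  field_simp

/-- The factorization for one point, integrated: this is `z Ξ' = Ξ ∫ ρ` at `-z`, order by order. The
index `p.1 + 1` appears because the one-point series has no constant term. -/
lemma IsBoltzmannKernel.sum_lintegral_corr_mul (he : IsBoltzmannKernel e)
    {B : ℕ → ℕ → ℝ≥0∞} (hB : ∀ M n, B M n ≠ ⊤) (h : ∀ M n x, corr e ν M n x ≤ B M n)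
    (M : ℕ) :
    ∑ p ∈ Finset.HasAntidiagonal.antidiagonal M, (∫⁻ x, corr e ν (p.1 + 1) 1 (fun _ => x) ∂ν).toReal *
      ((-1) ^ p.2 * gasIntegral e ν p.2 (Fin.elim0 : Fin 0 → E)) =
      (-1) ^ M * ((M + 1) * gasIntegral e ν (M + 1) (Fin.elim0 : Fin 0 → E)) := by
  have hmeas : ∀ k, Measurable fun x => corr e ν k 1 (fun _ => x) := fun k =>
    (he.measurable_corr k 1).comp (measurable_pi_iff.2 fun _ => measurable_id)
  have h1 := fun x => he.signedGasIntegral_eq_sum hB h (M + 1) (fun _ : Fin 1 => x)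
  simp only [Finset.Nat.sum_antidiagonal_succ, corr_zero_succ, ENNReal.toReal_zero, zero_mul,
    zero_add, signedGasIntegral, Nat.le_add_left, if_true, Nat.add_sub_cancel] at h1
  rw [← he.integral_gasIntegral_one, ← integral_const_mul]
  simp only [h1]
  rw [integral_finsetSum]
  · refine Finset.sum_congr rfl fun p _ => ?_
    rw [integral_mul_const, integral_toReal (hmeas _).aemeasurable
      (ae_of_all _ fun x => (h _ _ _).trans_lt (hB _ _).lt_top)]
  · intro p _
    exact (integrable_of_bounds (hmeas _).ennreal_toReal (fun _ => ENNReal.toReal_nonneg)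
      fun x => ENNReal.toReal_mono (hB _ _) (h _ _ _)).mul_const _

end OnePoint

/-! ### Monotonicity and continuity in the region -/

section Regions

variable {E : Type*} [MeasureSpace E] [SigmaFinite (volume : Measure E)] {e : E → E → ℝ}

lemma pi_restrict_eq (Λ : Set E) (ι : Type*) [Fintype ι] :
    (Measure.pi fun _ : ι => (volume : Measure E).restrict Λ) =
      (Measure.pi fun _ : ι => (volume : Measure E)).restrict (Set.univ.pi fun _ => Λ) :=
  (Measure.restrict_pi_pi _ _).symm

lemma pi_restrict_mono {Λ Λ' : Set E} (h : Λ ⊆ Λ') (ι : Type*) [Fintype ι] :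
    (Measure.pi fun _ : ι => (volume : Measure E).restrict Λ) ≤
      Measure.pi fun _ : ι => (volume : Measure E).restrict Λ' := by
  rw [pi_restrict_eq, pi_restrict_eq]
  exact Measure.restrict_mono (Set.pi_mono fun _ _ => h) le_rfl

/-- Every term of the recursion is nonnegative, so enlarging the domain of integration can only
increase it. The signed coefficients would not allow this comparison. -/
lemma corr_restrict_mono {Λ Λ' : Set E} (h : Λ ⊆ Λ') (M : ℕ) {n : ℕ} (x : Fin n → E) :
    corr e (volume.restrict Λ) M n x ≤ corr e (volume.restrict Λ') M n x := by
  induction M generalizing n with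
  | zero => rcases n with _ | n <;> simp [corr_zero_zero, corr_zero_succ]
  | succ M ih =>
    rcases n with _ | n
    · simp [corr_succ_zero]
    rw [corr_succ_succ, corr_succ_succ]
    gcongr with k _
    · exact pi_restrict_mono h _
    · exact ih _

lemma corr_restrict_le {Λ : Set E} (M : ℕ) {n : ℕ} (x : Fin n → E) :
    corr e (volume.restrict Λ) M n x ≤ corr e volume M n x := by
  simpa using corr_restrict_mono (e := e) (Set.subset_univ Λ) M x

lemma IsBoltzmannKernel.tendsto_corr_restrict (he : IsBoltzmannKernel e) {Λ : ℕ → Set E}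
    (hΛ : ∀ k, MeasurableSet (Λ k)) (hmono : Monotone Λ) (hunion : ∀ x, ∃ k, x ∈ Λ k) (M : ℕ)
    {n : ℕ} (x : Fin n → E) :
    Tendsto (fun R => corr e (volume.restrict (Λ R)) M n x) atTop (𝓝 (corr e volume M n x)) := by
  induction M generalizing n with
  | zero => rcases n with _ | n <;> simp [corr_zero_zero, corr_zero_succ]
  | succ M ih =>
    rcases n with _ | n
    · simp [corr_succ_zero]
    simp only [corr_succ_succ]
    refine ENNReal.Tendsto.const_mul (tendsto_finsetSum _ fun k _ =>
      ENNReal.Tendsto.const_mul ?_ (.inr (by simp [Nat.factorial_ne_zero])))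
      (.inr ENNReal.ofReal_ne_top)
    have hpi : ∀ R, MeasurableSet (Set.univ.pi fun _ : Fin k => Λ R) := fun R =>
      MeasurableSet.univ_pi fun _ => hΛ R
    -- Indicators put all integrals on one space, where integrand and domain grow together and
    -- monotone convergence applies.
    simp only [pi_restrict_eq, ← lintegral_indicator (hpi _)]
    refine lintegral_tendsto_of_tendsto_of_monotone
      (fun R => ((he.measurable_corr_integrand_right M k x).indicator (hpi R)).aemeasurable)
      (ae_of_all _ fun y R R' hR => ?_) (ae_of_all _ fun y => ?_)
    · refine (Set.indicator_le_indicator_of_subset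
        (Set.pi_mono fun _ _ => hmono hR) (fun _ => zero_le) y).trans
        (Set.indicator_le_indicator (mul_le_mul_right (corr_restrict_mono (hmono hR) M _) _))
    · choose K hK using fun j => hunion (y j)
      have hev : ∀ᶠ R in atTop, y ∈ Set.univ.pi fun _ : Fin k => Λ R :=
        (eventually_ge_atTop (Finset.univ.sup K)).mono fun R hR j _ =>
          hmono ((Finset.le_sup (Finset.mem_univ j)).trans hR) (hK j)
      refine (ENNReal.Tendsto.const_mul (ih _) (.inr ENNReal.ofReal_ne_top)).congr'
        (hev.mono fun R hR => ?_)
      exact (Set.indicator_of_mem hR (fun y : Fin k → E =>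
        ENNReal.ofReal (∏ j, (1 - e (x 0) (y j))) *
          corr e (volume.restrict (Λ R)) M (n + k) (Fin.append (Fin.tail x) y))).symm

end Regions

/-! ### Invariance under translations -/

section Translation

variable {E : Type*} [MeasurableSpace E] {e : E → E → ℝ} {ν ν' : Measure E}
  [SigmaFinite ν'] {T : E → E}

omit [MeasurableSpace E] in
lemma pairWeight_comp_of_invariant (hT : ∀ x y, e (T x) (T y) = e x y) {ι : Type*} [Fintype ι]
    (x : ι → E) : pairWeight e (fun i => T (x i)) = pairWeight e x := by
  simp [pairWeight, hT]

/-- Two measures are allowed so that one statement covers translations of the whole space and of a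
ball onto its translate. -/
lemma IsBoltzmannKernel.corr_comp_of_invariant (he : IsBoltzmannKernel e)
    (hT : ∀ x y, e (T x) (T y) = e x y) (hν : MeasurePreserving T ν ν') (M : ℕ) {n : ℕ}
    (x : Fin n → E) : corr e ν' M n (fun i => T (x i)) = corr e ν M n x := by
  induction M generalizing n with
  | zero => rcases n with _ | n <;> simp [corr_zero_zero, corr_zero_succ]
  | succ M ih =>
    rcases n with _ | n
    · simp [corr_succ_zero]
    simp only [corr_succ_succ]
    congr 1
    · simp [Fin.tail, hT]
    · refine Finset.sum_congr rfl fun k _ => ?_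
      rw [← (measurePreserving_pi (fun _ : Fin k => ν) (fun _ => ν') fun _ => hν).lintegral_comp
        (he.measurable_corr_integrand_right M k fun i => T (x i))]
      congr 2
      ext y
      rw [← ih]
      simp only [hT]
      congr 2
      ext i
      refine Fin.addCases (fun i => ?_) (fun i => ?_) i <;> simp [Fin.tail]

lemma IsBoltzmannKernel.lintegral_prod_mul_pairWeight_comp (he : IsBoltzmannKernel e)
    (hT : ∀ x y, e (T x) (T y) = e x y) (hν : MeasurePreserving T ν ν') (k : ℕ) (a : E) :
    ∫⁻ y : Fin k → E, ENNReal.ofReal (∏ j, (1 - e (T a) (y j))) *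
        ENNReal.ofReal (pairWeight e y) ∂(Measure.pi fun _ => ν') =
      ∫⁻ y : Fin k → E, ENNReal.ofReal (∏ j, (1 - e a (y j))) *
        ENNReal.ofReal (pairWeight e y) ∂(Measure.pi fun _ => ν) := by
  rw [← (measurePreserving_pi (fun _ : Fin k => ν) (fun _ => ν') fun _ => hν).lintegral_comp]
  · simp only [hT, pairWeight_comp_of_invariant hT]
  · exact Measurable.mul (Measurable.ennreal_ofReal (Finset.measurable_fun_prod _ fun j _ =>
      measurable_const.sub (he.measurable_comp measurable_const (measurable_pi_apply j))))
      he.measurable_pairWeight.ennreal_ofReal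

end Translation

/-! ### Averages over van Hove sequences -/

section VanHove

variable {d : ℕ} {e : Space d → Space d → ℝ}

/-- A ball is connected, so one that meets both `Λ` and its complement meets the frontier. -/
lemma closedBall_subset_of_notMem_cthickening {F : Type*} [NormedAddCommGroup F]
    [NormedSpace ℝ F] {Λ : Set F} {x : F} {R : ℝ} (hR : 0 ≤ R) (hx : x ∈ Λ)
    (hx' : x ∉ Metric.cthickening R (frontier Λ)) : Metric.closedBall x R ⊆ Λ := by
  by_contra hsub
  obtain ⟨y, hy, hyΛ⟩ := Set.not_subset.1 hsub
  have hconn : IsPreconnected (Metric.closedBall x R) := (convex_closedBall x R).isPreconnected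
  obtain ⟨z, hz, hzf⟩ : (Metric.closedBall x R ∩ frontier Λ).Nonempty := by
    by_contra hne
    rw [Set.not_nonempty_iff_eq_empty] at hne
    have hcover : Metric.closedBall x R ⊆ interior Λ ∪ (closure Λ)ᶜ := fun z hz => by
      by_contra hz'
      simp only [Set.mem_union, Set.mem_compl_iff, not_or, not_not] at hz'
      exact (Set.eq_empty_iff_forall_notMem.1 hne z) ⟨hz, hz'.2, hz'.1⟩
    have hxi : x ∈ interior Λ := (hcover (Metric.mem_closedBall_self hR)).resolve_right
      fun h => h (subset_closure hx)
    have hyi : y ∈ (closure Λ)ᶜ := (hcover hy).resolve_left fun h => hyΛ (interior_subset h)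
    obtain ⟨z, -, hz1, hz2⟩ := hconn _ _ isOpen_interior isClosed_closure.isOpen_compl hcover
      ⟨x, Metric.mem_closedBall_self hR, hxi⟩ ⟨y, hy, hyi⟩
    exact hz2 (interior_subset_closure hz1)
  exact hx' (Metric.mem_cthickening_of_dist_le x z R _ hzf (by
    rw [dist_comm]; exact Metric.mem_closedBall.1 hz))

lemma IsBoltzmannKernel.corr_closedBall (he : IsBoltzmannKernel e)
    (ht : ∀ a x y, e (x + a) (y + a) = e x y) (R : ℝ) (M : ℕ) (x : Space d) :
    corr e (volume.restrict (Metric.closedBall x R)) M 1 (fun _ => x) =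
      corr e (volume.restrict (Metric.closedBall 0 R)) M 1 (fun _ => 0) := by
  have h := (measurePreserving_add_right (volume : Measure (Space d)) x).restrict_preimage
    (Metric.isClosed_closedBall (x := x) (ε := R)).measurableSet
  have hb : (fun y => y + x) ⁻¹' Metric.closedBall x R = Metric.closedBall 0 R := by
    ext y; simp [dist_eq_norm]
  rw [hb] at h
  simpa using he.corr_comp_of_invariant (ht x) h M (fun _ : Fin 1 => 0)

lemma IsBoltzmannKernel.corr_volume (he : IsBoltzmannKernel e)
    (ht : ∀ a x y, e (x + a) (y + a) = e x y) (M : ℕ) (x : Space d) :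
    corr e volume M 1 (fun _ => x) = corr e volume M 1 (fun _ => 0) := by
  simpa using he.corr_comp_of_invariant (ht x)
    (measurePreserving_add_right (volume : Measure (Space d)) x) M (fun _ : Fin 1 => 0)

lemma IsBoltzmannKernel.setLIntegral_corr_le (he : IsBoltzmannKernel e)
    (ht : ∀ a x y, e (x + a) (y + a) = e x y) (M : ℕ) (Λ : Set (Space d)) :
    ∫⁻ x in Λ, corr e (volume.restrict Λ) M 1 (fun _ => x) ≤
      corr e volume M 1 (fun _ => 0) * volume Λ := by
  calc _ ≤ ∫⁻ _ in Λ, corr e volume M 1 (fun _ => (0 : Space d)) := lintegral_mono fun x =>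
        (corr_restrict_le M _).trans_eq (he.corr_volume ht M x)
    _ = _ := by simp

/-- Away from the boundary layer, a point sees a full ball of radius `R` inside `Λ`; monotonicity
and translation bound the integrand below by the value at the centre of that ball. -/
lemma IsBoltzmannKernel.le_setLIntegral_corr (he : IsBoltzmannKernel e)
    (ht : ∀ a x y, e (x + a) (y + a) = e x y) (M : ℕ) {Λ : Set (Space d)}
    (hΛ : MeasurableSet Λ) {R : ℝ} (hR : 0 ≤ R) :
    corr e (volume.restrict (Metric.closedBall 0 R)) M 1 (fun _ => (0 : Space d)) *
        (volume Λ - volume (Metric.cthickening R (frontier Λ))) ≤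
      ∫⁻ x in Λ, corr e (volume.restrict Λ) M 1 (fun _ => x) := by
  set K := Metric.cthickening R (frontier Λ)
  calc _ ≤ corr e (volume.restrict (Metric.closedBall 0 R)) M 1 (fun _ => (0 : Space d)) *
        volume (Λ \ K) := by gcongr; exact le_measure_sdiff
    _ = ∫⁻ _ in Λ \ K, corr e (volume.restrict (Metric.closedBall 0 R)) M 1
          (fun _ => (0 : Space d)) := by simp
    _ ≤ ∫⁻ x in Λ \ K, corr e (volume.restrict Λ) M 1 (fun _ => x) := by
      refine setLIntegral_mono' (hΛ.diff Metric.isClosed_cthickening.measurableSet) fun x hx => ?_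
      rw [← he.corr_closedBall ht R M x]
      exact corr_restrict_mono (closedBall_subset_of_notMem_cthickening hR hx.1 hx.2) M _
    _ ≤ _ := lintegral_mono_set Set.sdiff_subset

lemma IsBoltzmannKernel.tendsto_setLIntegral_corr (he : IsBoltzmannKernel e)
    (ht : ∀ a x y, e (x + a) (y + a) = e x y) {Λ : ℕ → Set (Space d)} (hΛ : IsVanHove Λ) (M : ℕ) :
    Tendsto (fun k => (∫⁻ x in Λ k, corr e (volume.restrict (Λ k)) M 1 (fun _ => x)) /
      volume (Λ k)) atTop (𝓝 (corr e volume M 1 (fun _ => (0 : Space d)))) := by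
  have hlim := he.tendsto_corr_restrict (Λ := fun R : ℕ => Metric.closedBall (0 : Space d) R)
    (fun R => Metric.isClosed_closedBall.measurableSet)
    (fun R R' h => Metric.closedBall_subset_closedBall (by exact_mod_cast h))
    (fun x => (exists_nat_ge ‖x‖).imp fun k hk => by simpa using hk) M (fun _ : Fin 1 => 0)
  refine tendsto_order.2 ⟨fun a ha => ?_, fun a ha => Eventually.of_forall fun k => ?_⟩
  -- The radius is fixed before the region grows; it must be positive for the van Hove condition to
  -- apply.
  · obtain ⟨R, hRa, hR0⟩ := ((hlim.eventually_const_lt ha).and (eventually_gt_atTop 0)).exists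
    set c := corr e (volume.restrict (Metric.closedBall (0 : Space d) R)) M 1 (fun _ => 0)
    have hb := hΛ.boundary_tendsto R (by exact_mod_cast hR0)
    have h1 := ENNReal.Tendsto.const_mul (a := c)
      (ENNReal.Tendsto.sub (tendsto_const_nhds (x := (1 : ℝ≥0∞))) hb (.inl ENNReal.one_ne_top))
      (.inl (by simp))
    rw [tsub_zero, mul_one] at h1
    refine (h1.eventually_const_lt hRa).mono fun k hk => hk.trans_le ?_
    have hk0 := (hΛ.isRegion k).volume_ne_zero
    have hkt := (hΛ.isRegion k).volume_ne_top
    rw [ENNReal.le_div_iff_mul_le (.inl hk0) (.inl hkt), mul_assoc,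
      ENNReal.sub_mul fun _ _ => hkt, one_mul, ENNReal.div_mul_cancel hk0 hkt]
    exact he.le_setLIntegral_corr ht M (hΛ.isRegion k).measurableSet (Nat.cast_nonneg R)
  · exact (ENNReal.div_le_of_le_mul (he.setLIntegral_corr_le ht M (Λ k))).trans_lt ha

end VanHove

/-! ### Power series and logarithms -/

section PowerSeries

variable {a : ℕ → ℂ} {r : ℝ}

lemma norm_mul_pow_le_of_norm_le {z : ℂ} (hz : ‖z‖ ≤ r) (c : ℂ) (n : ℕ) :
    ‖c * z ^ n‖ ≤ ‖c‖ * r ^ n := by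
  rw [norm_mul, norm_pow]
  gcongr

lemma summable_norm_mul_pow_of_derivative (hr : 0 ≤ r)
    (ha : Summable fun n : ℕ => ‖((n : ℂ) + 1) * a (n + 1)‖ * r ^ n) :
    Summable fun n => ‖a n‖ * r ^ n := by
  refine (summable_nat_add_iff 1).1 (.of_nonneg_of_le (fun n => by positivity) (fun n => ?_)
    (ha.mul_right r))
  have h1 : ‖(n : ℂ) + 1‖ = n + 1 := by exact_mod_cast Complex.norm_natCast (n + 1)
  rw [norm_mul, h1, pow_succ, mul_assoc, mul_assoc]
  exact le_mul_of_one_le_left (by positivity) (by linarith [n.cast_nonneg (α := ℝ)])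

lemma continuousOn_tsum_mul_pow (ha : Summable fun n => ‖a n‖ * r ^ n) :
    ContinuousOn (fun z => ∑' n, a n * z ^ n) (Metric.closedBall 0 r) :=
  continuousOn_tsum (fun n => by fun_prop) ha fun n z hz =>
    norm_mul_pow_le_of_norm_le (by simpa using hz) _ _

lemma tsum_mul_zero_pow (a : ℕ → ℂ) : ∑' n, a n * (0 : ℂ) ^ n = a 0 := by
  rw [tsum_eq_single 0 fun n hn => by simp [hn]]
  simp

lemma hasDerivAt_tsum_mul_pow
    (ha : Summable fun n : ℕ => ‖((n : ℂ) + 1) * a (n + 1)‖ * r ^ n) {z : ℂ}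
    (hz : z ∈ Metric.ball (0 : ℂ) r) :
    HasDerivAt (fun z => ∑' n, a n * z ^ n) (∑' n : ℕ, ((n : ℂ) + 1) * a (n + 1) * z ^ n) z := by
  have hr : 0 < r := Metric.pos_of_mem_ball hz
  have hu : Summable fun n : ℕ => ‖(n : ℂ) * a n‖ * r ^ (n - 1) :=
    (summable_nat_add_iff 1).1 (by simpa using ha)
  have hbound : ∀ n : ℕ, ∀ y ∈ Metric.ball (0 : ℂ) r,
      ‖(n : ℂ) * a n * y ^ (n - 1)‖ ≤ ‖(n : ℂ) * a n‖ * r ^ (n - 1) := fun n y hy =>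
    norm_mul_pow_le_of_norm_le (by simpa using (Metric.mem_ball.1 hy).le) _ _
  have h := hasDerivAt_tsum_of_isPreconnected (g := fun n z => a n * z ^ n)
    (g' := fun n z => (n : ℂ) * a n * z ^ (n - 1)) hu Metric.isOpen_ball
    (convex_ball (0 : ℂ) r).isPreconnected
    (fun n y _ => ((hasDerivAt_pow n y).const_mul (a n)).congr_deriv (by ring)) hbound
    (Metric.mem_ball_self hr) (summable_of_ne_finset_zero (s := {0}) fun n hn => by
      simp only [Finset.mem_singleton] at hn; simp [hn]) hz
  refine h.congr_deriv ?_
  rw [(Summable.of_norm_bounded hu fun n => hbound n z hz).tsum_eq_zero_add]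
  simp

/-- A power series `a` whose derivative is the logarithmic derivative of the power series `ξ` is a
logarithm of `ξ`. -/
lemma exp_tsum_eq_tsum_of_logDeriv {ξ : ℕ → ℂ} (hr : 0 < r) (ha0 : a 0 = 0) (hξ0 : ξ 0 = 1)
    (ha : Summable fun n : ℕ => ‖((n : ℂ) + 1) * a (n + 1)‖ * r ^ n)
    (hξ : Summable fun n : ℕ => ‖((n : ℂ) + 1) * ξ (n + 1)‖ * r ^ n)
    (h : ∀ M : ℕ, ∑ p ∈ Finset.HasAntidiagonal.antidiagonal M,
      ((p.1 : ℂ) + 1) * a (p.1 + 1) * ξ p.2 = ((M : ℂ) + 1) * ξ (M + 1))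
    {z : ℂ} (hz : ‖z‖ ≤ r) : Complex.exp (∑' n, a n * z ^ n) = ∑' n, ξ n * z ^ n := by
  have has := summable_norm_mul_pow_of_derivative hr.le ha
  have hξs := summable_norm_mul_pow_of_derivative hr.le hξ
  have hball : Set.EqOn (fun z => Complex.exp (∑' n, a n * z ^ n)) (fun z => ∑' n, ξ n * z ^ n)
      (Metric.ball 0 r) := fun z hz => by
    -- Working with `exp (-a) ξ`, which turns out constant, avoids dividing by `ξ`: its nonvanishing
    -- is a consequence, not an assumption.
    have hder : ∀ w ∈ Metric.ball (0 : ℂ) r, HasDerivAt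
        (fun w => Complex.exp (-∑' n, a n * w ^ n) * ∑' n, ξ n * w ^ n) 0 w := fun w hw => by
      have hw' : ‖w‖ ≤ r := by simpa using (Metric.mem_ball.1 hw).le
      have hsum : ∀ {c : ℕ → ℂ}, (Summable fun n => ‖c n‖ * r ^ n) →
          Summable fun n => ‖c n * w ^ n‖ := fun hc =>
        .of_nonneg_of_le (fun _ => norm_nonneg _)
          (fun n => norm_mul_pow_le_of_norm_le hw' _ _) hc
      have hprod : (∑' n : ℕ, ((n : ℂ) + 1) * a (n + 1) * w ^ n) * ∑' n, ξ n * w ^ n =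
          ∑' n : ℕ, ((n : ℂ) + 1) * ξ (n + 1) * w ^ n := by
        rw [tsum_mul_tsum_eq_tsum_sum_antidiagonal_of_summable_norm (hsum ha) (hsum hξs)]
        refine tsum_congr fun n => ?_
        rw [← h, Finset.sum_mul]
        refine Finset.sum_congr rfl fun p hp => ?_
        rw [← Finset.HasAntidiagonal.mem_antidiagonal.1 hp, pow_add]
        ring
      refine ((hasDerivAt_tsum_mul_pow ha hw).neg.cexp.mul
        (hasDerivAt_tsum_mul_pow hξ hw)).congr_deriv ?_
      rw [← hprod]
      ring
    have hconst := Metric.isOpen_ball.is_const_of_deriv_eq_zero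
      (convex_ball (0 : ℂ) r).isPreconnected
      (fun w hw => (hder w hw).differentiableAt.differentiableWithinAt)
      (fun w hw => (hder w hw).deriv) hz (Metric.mem_ball_self hr)
    simp only [tsum_mul_zero_pow, ha0, hξ0, neg_zero, Complex.exp_zero, mul_one] at hconst
    rw [Complex.exp_neg] at hconst
    exact (inv_mul_eq_one₀ (Complex.exp_ne_zero _)).1 hconst
  -- Absolute convergence at radius `r` makes both sides continuous up to the boundary circle.
  exact hball.of_subset_closure (continuousOn_tsum_mul_pow has).cexp
    (continuousOn_tsum_mul_pow hξs) Metric.ball_subset_closedBall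
    (closure_ball (0 : ℂ) hr.ne').ge (by simpa using hz)

lemma iteratedDeriv_div_factorial_of_hasSum {f : ℂ → ℂ}
    (h : ∀ᶠ z in 𝓝 0, HasSum (fun n => a n * z ^ n) (f z)) (n : ℕ) :
    iteratedDeriv n f 0 / (n.factorial : ℂ) = a n := by
  have h1 : HasFPowerSeriesAt f (FormalMultilinearSeries.ofScalars ℂ a) 0 := by
    refine hasFPowerSeriesAt_iff.2 (h.mono fun z hz => ?_)
    simpa [FormalMultilinearSeries.coeff_ofScalars, mul_comm] using hz
  have h2 := h1.analyticAt.hasFPowerSeriesAt.eq_formalMultilinearSeries h1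
  simpa [FormalMultilinearSeries.coeff_ofScalars] using
    congrArg (fun p : FormalMultilinearSeries ℂ ℂ ℂ => p.coeff n) h2

end PowerSeries

/-! ### Boltzmann factors of the interaction -/

section Boltzmann

variable {β : ℝ}

lemma boltzmann_nonneg (u : ℝ≥0∞) : 0 ≤ boltzmann β u := by
  unfold boltzmann
  split_ifs <;> positivity

lemma boltzmann_le_one (hβ : 0 < β) (u : ℝ≥0∞) : boltzmann β u ≤ 1 := by
  unfold boltzmann
  split_ifs
  · exact zero_le_one
  · exact Real.exp_le_one_iff.2 (by nlinarith [ENNReal.toReal_nonneg (a := u)])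

lemma measurable_boltzmann : Measurable (boltzmann β) :=
  Measurable.ite (measurableSet_singleton ⊤) measurable_const
    (Real.measurable_exp.comp (measurable_const.mul ENNReal.measurable_toReal))

lemma boltzmann_zero : boltzmann β 0 = 1 := by simp [boltzmann]

lemma boltzmann_add (u v : ℝ≥0∞) : boltzmann β (u + v) = boltzmann β u * boltzmann β v := by
  unfold boltzmann
  by_cases hu : u = ⊤
  · simp [hu]
  by_cases hv : v = ⊤
  · simp [hv]
  simp only [hu, hv, ENNReal.add_eq_top, or_self, if_false]
  rw [ENNReal.toReal_add hu hv, mul_add, Real.exp_add]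

lemma boltzmann_sum {ι : Type*} (s : Finset ι) (u : ι → ℝ≥0∞) :
    boltzmann β (∑ i ∈ s, u i) = ∏ i ∈ s, boltzmann β (u i) := by
  classical
  induction s using Finset.induction_on with
  | empty => simp [boltzmann_zero]
  | insert i s hi ih => rw [Finset.sum_insert hi, Finset.prod_insert hi, boltzmann_add, ih]

lemma IsInteraction.isBoltzmannKernel {d : ℕ} {φ : Space d → Space d → ℝ≥0∞}
    (hφ : IsInteraction φ) (hβ : 0 < β) :
    IsBoltzmannKernel fun x y => boltzmann β (φ x y) where
  measurable := measurable_boltzmann.comp hφ.measurable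
  nonneg _ _ := boltzmann_nonneg _
  le_one _ _ := boltzmann_le_one hβ _
  symm x y := by rw [hφ.symm]

lemma IsBoltzmannKernel.prod_prod_Ioi_eq_pairWeight {E : Type*} [MeasurableSpace E]
    {e : E → E → ℝ} (he : IsBoltzmannKernel e) {n : ℕ} (x : Fin n → E) :
    ∏ i, ∏ j ∈ Finset.Ioi i, e (x i) (x j) = pairWeight e x := by
  classical
  have h0 : 0 ≤ ∏ i, ∏ j ∈ Finset.Ioi i, e (x i) (x j) :=
    Finset.prod_nonneg fun _ _ => Finset.prod_nonneg fun _ _ => he.nonneg _ _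
  unfold pairWeight
  rw [← Real.sqrt_sq h0]
  congr 1
  have h1 := Finset.prod_prod_Ioi_mul_eq_prod_prod_off_diag (fun i j => e (x i) (x j))
  have h2 : ∀ i, ∏ j, (if i = j then 1 else e (x i) (x j)) = ∏ j ∈ {i}ᶜ, e (x j) (x i) :=
    fun i => by
      rw [← Finset.prod_compl_mul_prod {i}, Finset.prod_singleton, if_pos rfl, mul_one]
      refine Finset.prod_congr rfl fun j hj => ?_
      rw [if_neg (fun h => by simp [h] at hj), he.symm]
  refine Eq.trans ?_ (Finset.prod_congr rfl fun i _ => by convert (h2 i).symm)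
  rw [← h1, ← Finset.prod_pow]
  refine Finset.prod_congr rfl fun i _ => ?_
  rw [← Finset.prod_pow]
  exact Finset.prod_congr rfl fun j _ => by rw [he.symm (x j), sq]

end Boltzmann

/-! ### The vertex sum and admissibility of `μ / Ψ(μ)` -/

section VertexSum

variable {d : ℕ} {β : ℝ} {φ : Space d → Space d → ℝ≥0∞}

lemma IsInteraction.siblingWeight_eq (hφ : IsInteraction φ) (hβ : 0 < β) {n : ℕ} (x : Space d)
    (y : Fin n → Space d) : siblingWeight β φ x y = (∏ i, (1 - boltzmann β (φ x (y i)))) *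
      pairWeight (fun x y => boltzmann β (φ x y)) y := by
  rw [siblingWeight, (hφ.isBoltzmannKernel hβ).prod_prod_Ioi_eq_pairWeight]

lemma IsInteraction.integrable_one_sub_boltzmann (hφ : IsInteraction φ) (hβ : 0 < β)
    (hC : temperedness β φ < ⊤) : Integrable fun x : Space d => 1 - boltzmann β (φ 0 x) := by
  have he := hφ.isBoltzmannKernel hβ
  refine ⟨(measurable_const.sub
    (he.measurable_comp measurable_const measurable_id)).aestronglyMeasurable, ?_⟩
  refine lt_of_eq_of_lt (lintegral_congr fun x => ?_) hC
  rw [hφ.symm, ← Real.enorm_eq_ofReal_abs, ← enorm_neg, neg_sub]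

lemma IsInteraction.siblingWeight_nonneg (hφ : IsInteraction φ) (hβ : 0 < β) {n : ℕ}
    (x : Space d) (y : Fin n → Space d) : 0 ≤ siblingWeight β φ x y := by
  rw [hφ.siblingWeight_eq hβ]
  exact mul_nonneg ((hφ.isBoltzmannKernel hβ).prod_one_sub_nonneg x y) (pairWeight_nonneg _)

lemma IsInteraction.siblingWeight_le (hφ : IsInteraction φ) (hβ : 0 < β) {n : ℕ}
    (x : Space d) (y : Fin n → Space d) :
    siblingWeight β φ x y ≤ ∏ i, (1 - boltzmann β (φ x (y i))) := by
  have he := hφ.isBoltzmannKernel hβ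
  rw [hφ.siblingWeight_eq hβ]
  exact mul_le_of_le_one_right (he.prod_one_sub_nonneg x y) (he.pairWeight_le_one _)

lemma IsInteraction.integrable_siblingWeight (hφ : IsInteraction φ) (hβ : 0 < β)
    (hC : temperedness β φ < ⊤) (n : ℕ) :
    Integrable fun y : Fin n → Space d => siblingWeight β φ 0 y := by
  have he := hφ.isBoltzmannKernel hβ
  refine (Integrable.fintype_prod (fun _ : Fin n =>
    hφ.integrable_one_sub_boltzmann hβ hC)).mono' ?_ (ae_of_all _ fun y => ?_)
  · simp only [hφ.siblingWeight_eq hβ]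
    exact ((Finset.measurable_fun_prod _ fun j _ => measurable_const.sub
      (he.measurable_comp measurable_const (measurable_pi_apply j))).mul
        he.measurable_pairWeight).aestronglyMeasurable
  · rw [Real.norm_of_nonneg (hφ.siblingWeight_nonneg hβ _ _)]
    exact hφ.siblingWeight_le hβ _ _

lemma IsInteraction.siblingIntegral_nonneg (hφ : IsInteraction φ) (hβ : 0 < β) (n : ℕ) :
    0 ≤ siblingIntegral β φ n := integral_nonneg fun _ => hφ.siblingWeight_nonneg hβ _ _

lemma IsInteraction.siblingIntegral_le (hφ : IsInteraction φ) (hβ : 0 < β)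
    (hC : temperedness β φ < ⊤) (n : ℕ) :
    siblingIntegral β φ n ≤ (∫ x : Space d, (1 - boltzmann β (φ 0 x))) ^ n := by
  refine (integral_mono (hφ.integrable_siblingWeight hβ hC n) (Integrable.fintype_prod
    fun _ : Fin n => hφ.integrable_one_sub_boltzmann hβ hC)
      fun y => hφ.siblingWeight_le hβ _ y).trans_eq ?_
  have := integral_fintype_prod_eq_pow (ι := Fin n) (μ := (volume : Measure (Space d)))
    (fun x => 1 - boltzmann β (φ 0 x))
  rw [Fintype.card_fin] at this
  exact this

lemma siblingIntegral_zero : siblingIntegral β φ 0 = 1 := by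
  simp [siblingIntegral, siblingWeight, volume_pi, Measure.real]

lemma IsInteraction.summable_vertexSum (hφ : IsInteraction φ) (hβ : 0 < β)
    (hC : temperedness β φ < ⊤) {μ : ℝ} (hμ : 0 < μ) :
    Summable fun n : ℕ => μ ^ n / (n.factorial : ℝ) * siblingIntegral β φ n := by
  set C := ∫ x : Space d, (1 - boltzmann β (φ 0 x))
  refine .of_nonneg_of_le (fun n => mul_nonneg (by positivity) (hφ.siblingIntegral_nonneg hβ n))
    (fun n => ?_) (Real.summable_pow_div_factorial (μ * C))
  rw [mul_pow, mul_div_right_comm]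
  gcongr
  exact hφ.siblingIntegral_le hβ hC n

lemma IsInteraction.vertexSum_eq_tsum (hφ : IsInteraction φ) (hβ : 0 < β)
    (hC : temperedness β φ < ⊤) {μ : ℝ} (hμ : 0 < μ) :
    vertexSum β φ μ = ∑' n : ℕ, μ ^ n / (n.factorial : ℝ) * siblingIntegral β φ n := by
  rw [(hφ.summable_vertexSum hβ hC hμ).tsum_eq_zero_add, siblingIntegral_zero, vertexSum]
  simp

lemma IsInteraction.one_le_vertexSum (hφ : IsInteraction φ) (hβ : 0 < β) {μ : ℝ} (hμ : 0 < μ) :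
    1 ≤ vertexSum β φ μ :=
  le_add_of_nonneg_right (tsum_nonneg fun n =>
    mul_nonneg (by positivity) (hφ.siblingIntegral_nonneg hβ _))

/-- Translation invariance moves the base point to the origin, where the sum is a partial sum of the
nonnegative series `Ψ(μ)`. -/
lemma IsInteraction.isAdmissible (hφ : IsInteraction φ) (hβ : 0 < β)
    (hC : temperedness β φ < ⊤) {μ : ℝ} (hμ : 0 < μ) :
    IsAdmissible (fun x y => boltzmann β (φ x y)) (volume : Measure (Space d))
      (ENNReal.ofReal (μ / vertexSum β φ μ)) (ENNReal.ofReal μ) := fun K a => by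
  have he := hφ.isBoltzmannKernel hβ
  have hΨ := hφ.one_le_vertexSum (φ := φ) hβ hμ
  have hterm : ∀ k : ℕ, (k.factorial : ℝ≥0∞)⁻¹ * (ENNReal.ofReal μ ^ k *
      ∫⁻ y : Fin k → Space d, ENNReal.ofReal (∏ j, (1 - boltzmann β (φ a (y j)))) *
        ENNReal.ofReal (pairWeight (fun x y => boltzmann β (φ x y)) y)
        ∂(Measure.pi fun _ => volume)) =
      ENNReal.ofReal (μ ^ k / (k.factorial : ℝ) * siblingIntegral β φ k) := fun k => by
    have h1 := he.lintegral_prod_mul_pairWeight_comp (T := fun x => x + a)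
      (fun x y => by rw [hφ.translation]) (measurePreserving_add_right volume a) k 0
    rw [zero_add] at h1
    rw [h1, div_mul_eq_mul_div, div_eq_inv_mul, ENNReal.ofReal_mul (by positivity),
      ENNReal.ofReal_mul (by positivity), ENNReal.ofReal_pow hμ.le, siblingIntegral,
      ofReal_integral_eq_lintegral_ofReal (hφ.integrable_siblingWeight hβ hC k)
        (ae_of_all _ fun y => hφ.siblingWeight_nonneg hβ _ y),
      ENNReal.ofReal_inv_of_pos (by positivity), ENNReal.ofReal_natCast]
    congr 2
    refine lintegral_congr fun y => ?_
    rw [hφ.siblingWeight_eq hβ, ENNReal.ofReal_mul (he.prod_one_sub_nonneg 0 y)]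
  simp only [hterm]
  have hnn : ∀ k : ℕ, 0 ≤ μ ^ k / (k.factorial : ℝ) * siblingIntegral β φ k := fun k =>
    mul_nonneg (by positivity) (hφ.siblingIntegral_nonneg hβ k)
  rw [← ENNReal.ofReal_sum_of_nonneg fun k _ => hnn k, ← ENNReal.ofReal_mul (by positivity)]
  refine ENNReal.ofReal_le_ofReal ?_
  have h2 := (hφ.summable_vertexSum hβ hC hμ).sum_le_tsum (Finset.range K) fun k _ => hnn k
  rw [← hφ.vertexSum_eq_tsum hβ hC hμ] at h2
  calc _ ≤ μ / vertexSum β φ μ * vertexSum β φ μ := by gcongr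
    _ = μ := div_mul_cancel₀ _ (by positivity)

end VertexSum

/-! ### The partition function as a power series -/

section Partition

variable {d : ℕ} {β : ℝ} {φ : Space d → Space d → ℝ≥0∞} {Λ : Set (Space d)}

lemma gasIntegral_elim0_nonneg {E : Type*} [MeasurableSpace E] {e : E → E → ℝ} {ν : Measure E}
    (n : ℕ) : 0 ≤ gasIntegral e ν n (Fin.elim0 : Fin 0 → E) :=
  mul_nonneg (by positivity) (integral_nonneg fun _ => pairWeight_nonneg _)

lemma IsBoltzmannKernel.gasIntegral_elim0_le {E : Type*} [MeasurableSpace E] {e : E → E → ℝ}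
    (he : IsBoltzmannKernel e) {ν : Measure E} [IsFiniteMeasure ν] (n : ℕ) :
    gasIntegral e ν n (Fin.elim0 : Fin 0 → E) ≤ ν.real Set.univ ^ n / (n.factorial : ℝ) := by
  rw [gasIntegral_elim0, div_eq_inv_mul]
  gcongr
  calc _ ≤ ∫ _ : Fin n → E, (1 : ℝ) ∂(Measure.pi fun _ => ν) :=
        integral_mono (integrable_of_bounds he.measurable_pairWeight pairWeight_nonneg
          he.pairWeight_le_one) (integrable_const _) he.pairWeight_le_one
    _ = _ := by simp [Measure.real, Measure.pi_univ, ENNReal.toReal_pow]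

lemma IsBoltzmannKernel.summable_gasIntegral {E : Type*} [MeasurableSpace E] {e : E → E → ℝ}
    (he : IsBoltzmannKernel e) {ν : Measure E} [IsFiniteMeasure ν] {r : ℝ} (hr : 0 ≤ r) :
    Summable fun n : ℕ =>
      ‖((n : ℂ) + 1) * (gasIntegral e ν (n + 1) (Fin.elim0 : Fin 0 → E) : ℂ)‖ * r ^ n := by
  refine .of_nonneg_of_le (fun n => by positivity) (fun n => ?_)
    ((Real.summable_pow_div_factorial (ν.real Set.univ * r)).mul_left (ν.real Set.univ))
  have h1 : ‖(n : ℂ) + 1‖ = n + 1 := by exact_mod_cast Complex.norm_natCast (n + 1)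
  rw [norm_mul, h1, Complex.norm_real, Real.norm_of_nonneg (gasIntegral_elim0_nonneg _), mul_pow]
  have h2 := he.gasIntegral_elim0_le (ν := ν) (n + 1)
  rw [Nat.factorial_succ] at h2
  push_cast at h2
  calc _ ≤ ((n : ℝ) + 1) * (ν.real Set.univ ^ (n + 1) / (((n : ℝ) + 1) * n.factorial)) * r ^ n :=
        by gcongr
    _ = _ := by field_simp; ring

lemma gasIntegral_elim0_zero {E : Type*} [MeasurableSpace E] {e : E → E → ℝ} {ν : Measure E}
    [SigmaFinite ν] : gasIntegral e ν 0 (Fin.elim0 : Fin 0 → E) = 1 := by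
  simp [gasIntegral_elim0, pairWeight_of_isEmpty, Measure.real]

lemma IsInteraction.partitionFunction_eq_tsum (hφ : IsInteraction φ) (hβ : 0 < β)
    (hΛ : IsRegion Λ) (z : ℂ) :
    partitionFunction β φ Λ z = ∑' n : ℕ, (gasIntegral (fun x y => boltzmann β (φ x y))
      (volume.restrict Λ) n (Fin.elim0 : Fin 0 → Space d) : ℂ) * z ^ n := by
  have he := hφ.isBoltzmannKernel hβ
  have : IsFiniteMeasure (volume.restrict Λ) := isFiniteMeasure_restrict.2 hΛ.volume_ne_top
  have hs := summable_norm_mul_pow_of_derivative (norm_nonneg z)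
    (a := fun n => (gasIntegral (fun x y => boltzmann β (φ x y))
      (volume.restrict Λ) n (Fin.elim0 : Fin 0 → Space d) : ℂ))
    (he.summable_gasIntegral (norm_nonneg z))
  have hs' : Summable fun n : ℕ => (gasIntegral (fun x y => boltzmann β (φ x y))
      (volume.restrict Λ) n (Fin.elim0 : Fin 0 → Space d) : ℂ) * z ^ n :=
    .of_norm_bounded hs fun n => norm_mul_pow_le_of_norm_le le_rfl _ _
  rw [hs'.tsum_eq_zero_add, gasIntegral_elim0_zero, partitionFunction]
  simp only [Complex.ofReal_one, pow_zero, mul_one]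
  congr 1
  refine tsum_congr fun n => ?_
  have hw : ∀ x : Fin (n + 1) → Space d, boltzmann β (energy φ x) =
      pairWeight (fun x y => boltzmann β (φ x y)) x := fun x => by
    simp only [energy, boltzmann_sum, ← he.prod_prod_Ioi_eq_pairWeight]
  rw [gasIntegral_elim0, pi_restrict_eq]
  simp only [hw]
  push_cast
  rw [div_mul_eq_mul_div, div_eq_inv_mul, volume_pi]
  ring

end Partition

/-! ### Coefficients of the cluster expansion and their bounds -/

section ClusterExpansion

variable {d : ℕ} {β : ℝ} {φ : Space d → Space d → ℝ≥0∞}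

/-- The `n`-th coefficient, up to sign and the factor `n`, of the infinite-volume cluster
expansion. -/
noncomputable def limitCorr (β : ℝ) (φ : Space d → Space d → ℝ≥0∞) (n : ℕ) : ℝ :=
  (corr (fun x y => boltzmann β (φ x y)) volume n 1 fun _ => (0 : Space d)).toReal

/-- The average over `Λ` of the `n`-th coefficient, up to sign, of the one-point correlation
function of the gas in `Λ`. -/
noncomputable def meanCorr (β : ℝ) (φ : Space d → Space d → ℝ≥0∞) (Λ : Set (Space d))
    (n : ℕ) : ℝ :=
  ((∫⁻ x in Λ, corr (fun x y => boltzmann β (φ x y)) (volume.restrict Λ) n 1 fun _ => x) /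
    volume Λ).toReal

/-- The coefficient of `z ^ n` in the cluster expansion whose one-point correlation function has
the coefficients `c`, up to sign. -/
noncomputable def expansionCoeff (c : ℕ → ℝ) (n : ℕ) : ℂ :=
  -(-1) ^ n * (c n : ℂ) / (n : ℂ)

/-- Division by zero has the value `0`, which is the constant term that a logarithm vanishing at the
origin requires. -/
lemma expansionCoeff_zero (c : ℕ → ℝ) : expansionCoeff c 0 = 0 := by simp [expansionCoeff]

lemma expansionCoeff_succ (c : ℕ → ℝ) (n : ℕ) :
    ((n : ℂ) + 1) * expansionCoeff c (n + 1) = (-1) ^ n * (c (n + 1) : ℂ) := by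
  have : (n : ℂ) + 1 ≠ 0 := by exact_mod_cast n.succ_ne_zero
  unfold expansionCoeff
  push_cast
  field_simp
  ring

lemma norm_expansionCoeff_le (c : ℕ → ℝ) (n : ℕ) : ‖expansionCoeff c n‖ ≤ |c n| := by
  rcases n.eq_zero_or_pos with rfl | hn
  · simp [expansionCoeff]
  · have : (1 : ℝ) ≤ n := by exact_mod_cast hn
    simpa [expansionCoeff] using div_le_self (abs_nonneg (c n)) this

lemma expansionCoeff_const_mul (V : ℝ) (c : ℕ → ℝ) (n : ℕ) :
    expansionCoeff (fun n => V * c n) n = (V : ℂ) * expansionCoeff c n := by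
  unfold expansionCoeff
  push_cast
  ring

lemma exp_tsum_expansionCoeff_eq {A G : ℕ → ℝ} {r : ℝ} (hr : 0 < r) (hA0 : ∀ n, 0 ≤ A n)
    (hA : Summable fun n => A (n + 1) * r ^ n) (hG0 : G 0 = 1)
    (hG : Summable fun n : ℕ => ‖((n : ℂ) + 1) * (G (n + 1) : ℂ)‖ * r ^ n)
    (h : ∀ M : ℕ, ∑ p ∈ Finset.HasAntidiagonal.antidiagonal M, A (p.1 + 1) *
      ((-1) ^ p.2 * G p.2) = (-1) ^ M * (((M : ℝ) + 1) * G (M + 1)))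
    {z : ℂ} (hz : ‖z‖ ≤ r) :
    Complex.exp (∑' n, expansionCoeff A n * z ^ n) = ∑' n, (G n : ℂ) * z ^ n := by
  refine exp_tsum_eq_tsum_of_logDeriv (a := expansionCoeff A) (ξ := fun n => (G n : ℂ)) hr (expansionCoeff_zero A) (by simp [hG0])
    (hA.congr fun n => ?_) hG (fun M => ?_) hz
  · rw [expansionCoeff_succ, norm_mul, norm_pow, norm_neg, norm_one, one_pow, one_mul,
      Complex.norm_real, Real.norm_of_nonneg (hA0 _)]
  -- Multiplication by `(-1) ^ M` undoes the substitution `z ↦ -z`.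
  · have h1 := congrArg (fun t : ℝ => (((-1) ^ M * t : ℝ) : ℂ)) (h M)
    simp only [Finset.mul_sum, Complex.ofReal_sum] at h1
    refine (Finset.sum_congr rfl fun p hp => ?_).trans (h1.trans ?_)
    · rw [expansionCoeff_succ, ← Finset.HasAntidiagonal.mem_antidiagonal.1 hp, pow_add]
      have : (-1 : ℂ) ^ p.2 * (-1) ^ p.2 = 1 := by rw [← mul_pow]; simp
      push_cast
      linear_combination (-(-1 : ℂ) ^ p.1 * A (p.1 + 1) * G p.2) * this
    · rw [← mul_assoc, ← mul_pow]
      push_cast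
      simp

section Bounds

variable {μ : ℝ}

lemma IsInteraction.corr_volume_le (hφ : IsInteraction φ) (hβ : 0 < β)
    (hC : temperedness β φ < ⊤) (hμ : 0 < μ) (Λ : Set (Space d)) (M n : ℕ)
    (x : Fin n → Space d) :
    corr (fun x y => boltzmann β (φ x y)) (volume.restrict Λ) M n x ≤
      (ENNReal.ofReal (μ / vertexSum β φ μ) ^ M)⁻¹ * ENNReal.ofReal μ ^ n := by
  have hΨ := hφ.one_le_vertexSum (φ := φ) hβ hμ
  exact (corr_restrict_le M x).trans ((hφ.isBoltzmannKernel hβ).corr_le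
    (hφ.isAdmissible hβ hC hμ) (by rw [Ne, ENNReal.ofReal_eq_zero, not_le]; positivity)
      ENNReal.ofReal_ne_top ENNReal.ofReal_ne_top M x)

lemma ofReal_pow_inv_mul_pow_ne_top {r μ : ℝ} (hr : 0 < r) (M n : ℕ) :
    (ENNReal.ofReal r ^ M)⁻¹ * ENNReal.ofReal μ ^ n ≠ ⊤ :=
  ENNReal.mul_ne_top (ENNReal.inv_ne_top.2 (pow_ne_zero _ (by simpa using hr))) (by finiteness)

lemma IsInteraction.radius_pos (hφ : IsInteraction φ) (hβ : 0 < β) (hμ : 0 < μ) :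
    0 < μ / vertexSum β φ μ :=
  div_pos hμ (zero_lt_one.trans_le (hφ.one_le_vertexSum hβ hμ))

lemma IsInteraction.corr_volume_ne_top (hφ : IsInteraction φ) (hβ : 0 < β)
    (hC : temperedness β φ < ⊤) (n : ℕ) :
    corr (fun x y => boltzmann β (φ x y)) volume n 1 (fun _ => (0 : Space d)) ≠ ⊤ := by
  -- The claim does not involve `μ`, so the choice `μ = 1` suffices.
  have h := hφ.corr_volume_le hβ hC one_pos Set.univ n 1 fun _ => 0
  rw [Measure.restrict_univ] at h
  exact ne_top_of_le_ne_top (ofReal_pow_inv_mul_pow_ne_top (hφ.radius_pos hβ one_pos) _ _) h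

lemma limitCorr_nonneg (n : ℕ) : 0 ≤ limitCorr β φ n := ENNReal.toReal_nonneg

lemma meanCorr_nonneg (Λ : Set (Space d)) (n : ℕ) : 0 ≤ meanCorr β φ Λ n :=
  ENNReal.toReal_nonneg

lemma IsInteraction.sum_limitCorr_le (hφ : IsInteraction φ) (hβ : 0 < β)
    (hC : temperedness β φ < ⊤) (hμ : 0 < μ) (N : ℕ) :
    ∑ n ∈ Finset.range N, limitCorr β φ n * (μ / vertexSum β φ μ) ^ n ≤ μ := by
  have h := (hφ.isBoltzmannKernel hβ).sum_corr_le (hφ.isAdmissible hβ hC hμ)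
    ENNReal.ofReal_ne_top N (fun _ : Fin 1 => 0)
  rw [pairWeight_of_unique, ENNReal.ofReal_one, mul_one, pow_one] at h
  have h' := ENNReal.toReal_mono ENNReal.ofReal_ne_top h
  rw [ENNReal.toReal_ofReal hμ.le, ENNReal.toReal_sum fun n _ => ENNReal.mul_ne_top
    (by finiteness) (hφ.corr_volume_ne_top hβ hC n)] at h'
  simpa [limitCorr, mul_comm, (hφ.radius_pos (φ := φ) hβ hμ).le] using h'

lemma IsInteraction.summable_limitCorr (hφ : IsInteraction φ) (hβ : 0 < β)
    (hC : temperedness β φ < ⊤) (hμ : 0 < μ) :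
    Summable fun n => limitCorr β φ n * (μ / vertexSum β φ μ) ^ n :=
  summable_of_sum_range_le (fun n => mul_nonneg (limitCorr_nonneg n)
    (pow_nonneg (hφ.radius_pos hβ hμ).le n)) (hφ.sum_limitCorr_le hβ hC hμ)

lemma IsInteraction.tsum_limitCorr_le (hφ : IsInteraction φ) (hβ : 0 < β)
    (hC : temperedness β φ < ⊤) (hμ : 0 < μ) :
    ∑' n, limitCorr β φ n * (μ / vertexSum β φ μ) ^ n ≤ μ :=
  Real.tsum_le_of_sum_range_le (fun n => mul_nonneg (limitCorr_nonneg n)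
    (pow_nonneg (hφ.radius_pos hβ hμ).le n)) (hφ.sum_limitCorr_le hβ hC hμ)

/-- One summable majorant for all regions: the source of uniformity in `Λ`. -/
lemma IsInteraction.meanCorr_le (hφ : IsInteraction φ) (hβ : 0 < β)
    (hC : temperedness β φ < ⊤) (Λ : Set (Space d)) (n : ℕ) :
    meanCorr β φ Λ n ≤ limitCorr β φ n :=
  ENNReal.toReal_mono (hφ.corr_volume_ne_top hβ hC n) (ENNReal.div_le_of_le_mul
    ((hφ.isBoltzmannKernel hβ).setLIntegral_corr_le
      (fun a x y => by rw [hφ.translation]) n Λ))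

lemma IsInteraction.tendsto_meanCorr (hφ : IsInteraction φ) (hβ : 0 < β)
    (hC : temperedness β φ < ⊤) {Λ : ℕ → Set (Space d)} (hΛ : IsVanHove Λ) (n : ℕ) :
    Tendsto (fun k => meanCorr β φ (Λ k) n) atTop (𝓝 (limitCorr β φ n)) :=
  (ENNReal.tendsto_toReal (hφ.corr_volume_ne_top hβ hC n)).comp
    ((hφ.isBoltzmannKernel hβ).tendsto_setLIntegral_corr
      (fun a x y => by rw [hφ.translation]) hΛ n)

lemma norm_expansionCoeff_mul_pow_le {c q : ℕ → ℝ} (h0 : ∀ n, 0 ≤ c n) (h : ∀ n, c n ≤ q n)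
    {r : ℝ} {z : ℂ} (hz : ‖z‖ ≤ r) (n : ℕ) : ‖expansionCoeff c n * z ^ n‖ ≤ q n * r ^ n := by
  refine (norm_mul_pow_le_of_norm_le hz _ n).trans ?_
  have : 0 ≤ r := (norm_nonneg z).trans hz
  gcongr
  exact (norm_expansionCoeff_le c n).trans ((abs_of_nonneg (h0 n)).trans_le (h n))

end Bounds

/-! ### The finite-volume pressure and its derivatives -/

section FiniteVolume

variable {μ : ℝ} {Λ : Set (Space d)}

lemma IsRegion.toReal_setLIntegral_corr (hΛ : IsRegion Λ) (n : ℕ) :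
    (∫⁻ x in Λ, corr (fun x y => boltzmann β (φ x y)) (volume.restrict Λ) n 1
      fun _ => x).toReal = volume.real Λ * meanCorr β φ Λ n := by
  have hV : volume.real Λ ≠ 0 := (ENNReal.toReal_pos hΛ.volume_ne_zero hΛ.volume_ne_top).ne'
  rw [meanCorr, ENNReal.toReal_div]
  exact (mul_div_cancel₀ _ hV).symm

lemma IsInteraction.sum_meanCorr_mul (hφ : IsInteraction φ) (hβ : 0 < β)
    (hC : temperedness β φ < ⊤) (hΛ : IsRegion Λ) (M : ℕ) :
    ∑ p ∈ Finset.HasAntidiagonal.antidiagonal M, volume.real Λ * meanCorr β φ Λ (p.1 + 1) *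
      ((-1) ^ p.2 * gasIntegral (fun x y => boltzmann β (φ x y)) (volume.restrict Λ) p.2
        (Fin.elim0 : Fin 0 → Space d)) =
      (-1) ^ M * ((M + 1) * gasIntegral (fun x y => boltzmann β (φ x y)) (volume.restrict Λ)
        (M + 1) (Fin.elim0 : Fin 0 → Space d)) := by
  have : IsFiniteMeasure (volume.restrict Λ) := isFiniteMeasure_restrict.2 hΛ.volume_ne_top
  rw [← (hφ.isBoltzmannKernel hβ).sum_lintegral_corr_mul
    (B := fun M n => (ENNReal.ofReal (1 / vertexSum β φ 1) ^ M)⁻¹ * ENNReal.ofReal 1 ^ n)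
    (fun M n => ofReal_pow_inv_mul_pow_ne_top (hφ.radius_pos hβ one_pos) M n)
    (fun M n x => hφ.corr_volume_le hβ hC one_pos Λ M n x)]
  simp only [hΛ.toReal_setLIntegral_corr]

lemma IsInteraction.summable_mul_meanCorr (hφ : IsInteraction φ) (hβ : 0 < β)
    (hC : temperedness β φ < ⊤) (hμ : 0 < μ) (Λ : Set (Space d)) {V : ℝ} (hV : 0 ≤ V) :
    Summable fun n : ℕ => V * meanCorr β φ Λ (n + 1) * (μ / vertexSum β φ μ) ^ n := by
  have hr := hφ.radius_pos (φ := φ) hβ hμ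
  refine .of_nonneg_of_le
    (fun n => mul_nonneg (mul_nonneg hV (meanCorr_nonneg Λ _)) (pow_nonneg hr.le n))
    (fun n => ?_) (((summable_nat_add_iff 1).2
      (hφ.summable_limitCorr hβ hC hμ)).mul_left (V / (μ / vertexSum β φ μ)))
  have h : V / (μ / vertexSum β φ μ) *
      (limitCorr β φ (n + 1) * (μ / vertexSum β φ μ) ^ (n + 1)) =
      V * limitCorr β φ (n + 1) * (μ / vertexSum β φ μ) ^ n := by
    generalize μ / vertexSum β φ μ = r at hr
    field_simp
    ring
  rw [h]
  gcongr
  exact hφ.meanCorr_le hβ hC Λ _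

lemma IsInteraction.exp_tsum_expansionCoeff (hφ : IsInteraction φ) (hβ : 0 < β)
    (hC : temperedness β φ < ⊤) (hμ : 0 < μ) (hΛ : IsRegion Λ) {z : ℂ}
    (hz : ‖z‖ ≤ μ / vertexSum β φ μ) :
    Complex.exp ((volume.real Λ : ℂ) * ∑' n, expansionCoeff (meanCorr β φ Λ) n * z ^ n) =
      partitionFunction β φ Λ z := by
  have : IsFiniteMeasure (volume.restrict Λ) := isFiniteMeasure_restrict.2 hΛ.volume_ne_top
  have hr := hφ.radius_pos (φ := φ) hβ hμ
  rw [hφ.partitionFunction_eq_tsum hβ hΛ, ← tsum_mul_left]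
  simp only [← mul_assoc, ← expansionCoeff_const_mul]
  exact exp_tsum_expansionCoeff_eq (A := fun n => volume.real Λ * meanCorr β φ Λ n)
    (G := fun n => gasIntegral (fun x y => boltzmann β (φ x y)) (volume.restrict Λ) n
      (Fin.elim0 : Fin 0 → Space d)) hr
    (fun n => mul_nonneg measureReal_nonneg (meanCorr_nonneg Λ n))
    (hφ.summable_mul_meanCorr hβ hC hμ Λ measureReal_nonneg) gasIntegral_elim0_zero
    ((hφ.isBoltzmannKernel hβ).summable_gasIntegral hr.le) (hφ.sum_meanCorr_mul hβ hC hΛ) hz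

lemma IsInteraction.clusterCoeff_div_factorial (hφ : IsInteraction φ) (hβ : 0 < β)
    (hC : temperedness β φ < ⊤) (hΛ : IsRegion Λ) (n : ℕ) :
    clusterCoeff β φ Λ n / (n.factorial : ℂ) = expansionCoeff (meanCorr β φ Λ) n := by
  have hr := hφ.radius_pos (φ := φ) hβ one_pos
  set r := 1 / vertexSum β φ 1
  set c := expansionCoeff (meanCorr β φ Λ)
  have hV : (volume.real Λ : ℂ) ≠ 0 := by
    exact_mod_cast (ENNReal.toReal_pos hΛ.volume_ne_zero hΛ.volume_ne_top).ne'
  have hs : Summable fun n => ‖c n‖ * r ^ n :=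
    .of_nonneg_of_le (fun n => by positivity) (fun n => by
      gcongr
      exact (norm_expansionCoeff_le _ n).trans ((abs_of_nonneg (meanCorr_nonneg _ _)).trans_le
        (hφ.meanCorr_le hβ hC Λ n))) (hφ.summable_limitCorr hβ hC one_pos)
  have hball : Metric.closedBall (0 : ℂ) r ∈ 𝓝 0 := Metric.closedBall_mem_nhds 0 hr
  have hcont : ContinuousAt (fun z => (volume.real Λ : ℂ) * ∑' n, c n * z ^ n) 0 :=
    ((continuousOn_tsum_mul_pow hs).continuousAt hball).const_mul _
  -- Near the origin the exponent has imaginary part in `(-π, π)`, so the principal logarithm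
  -- inverts the exponential.
  have hnear : ∀ᶠ z in 𝓝 0, ‖(volume.real Λ : ℂ) * ∑' n, c n * z ^ n‖ < Real.pi := by
    refine hcont.norm.eventually_lt_const ?_
    simp [tsum_mul_zero_pow, c, expansionCoeff_zero, Real.pi_pos]
  refine iteratedDeriv_div_factorial_of_hasSum ?_ n
  filter_upwards [hball, hnear] with z hz hπ
  have hz' : ‖z‖ ≤ r := by simpa using hz
  have him := (Complex.abs_im_le_norm _).trans_lt hπ
  rw [← hφ.exp_tsum_expansionCoeff hβ hC one_pos hΛ hz',
    Complex.log_exp (abs_lt.1 him).1 (abs_lt.1 him).2.le, mul_div_cancel_left₀ _ hV]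
  exact (Summable.of_norm_bounded hs fun n => norm_mul_pow_le_of_norm_le hz' _ _).hasSum

end FiniteVolume

/-! ### Uniform convergence -/

lemma partialExpansion_eq_sum_range {b : ℕ → ℂ} (hb : b 0 = 0) (N : ℕ) (z : ℂ) :
    partialExpansion b N z = ∑ n ∈ Finset.range (N + 1), b n / (n.factorial : ℂ) * z ^ n := by
  rw [Finset.range_eq_Ico, Finset.sum_eq_sum_Ico_succ_bot (Nat.succ_pos N)]
  simp only [hb, zero_div, zero_mul, zero_add, partialExpansion]
  rfl

/-- The Weierstrass test over an abstract parameter, which is a pair of region and fugacity in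
finite volume and a fugacity in infinite volume. -/
lemma tendstoUniformlyOn_partialExpansion {X : Type*} {b : X → ℕ → ℂ} {w : X → ℂ} {s : Set X}
    {u : ℕ → ℝ} (hu : Summable u) (hb : ∀ x ∈ s, b x 0 = 0)
    (h : ∀ n, ∀ x ∈ s, ‖b x n / (n.factorial : ℂ) * w x ^ n‖ ≤ u n) :
    TendstoUniformlyOn (fun N x => partialExpansion (b x) N (w x))
      (fun x => ∑' n, b x n / (n.factorial : ℂ) * w x ^ n) atTop s := by
  have h1 := tendstoUniformlyOn_tsum_nat hu h
  intro v hv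
  filter_upwards [(tendsto_add_atTop_nat 1).eventually (h1 v hv)] with N hN x hx
  rw [partialExpansion_eq_sum_range (hb x hx)]
  exact hN x hx

/-- On the disc the difference is at most `∑ ‖c n - b k n‖ r ^ n`, which is free of `z` and tends to
`0` by dominated convergence. -/
lemma tendstoUniformlyOn_tsum_mul_pow {b : ℕ → ℕ → ℂ} {c : ℕ → ℂ} {q : ℕ → ℝ} {r : ℝ}
    (hr : 0 ≤ r) (hq : Summable fun n => q n * r ^ n) (hb : ∀ k n, ‖b k n‖ ≤ q n)
    (hc : ∀ n, ‖c n‖ ≤ q n) (h : ∀ n, Tendsto (fun k => b k n) atTop (𝓝 (c n))) :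
    TendstoUniformlyOn (fun k (z : ℂ) => ∑' n, b k n * z ^ n) (fun z => ∑' n, c n * z ^ n) atTop
      {z | ‖z‖ ≤ r} := by
  have hlim : Tendsto (fun k => ∑' n, ‖c n - b k n‖ * r ^ n) atTop (𝓝 0) := by
    rw [← tsum_zero (α := ℝ) (β := ℕ)]
    refine tendsto_tsum_of_dominated_convergence (hq.mul_left 2) (fun n => ?_)
      (Eventually.of_forall fun k n => ?_)
    · simpa using (((tendsto_const_nhds (x := c n)).sub (h n)).norm).mul_const (r ^ n)
    · rw [Real.norm_of_nonneg (by positivity), ← mul_assoc]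
      gcongr
      linarith [norm_sub_le (c n) (b k n), hb k n, hc n]
  have hsum : ∀ {a : ℕ → ℂ}, (∀ n, ‖a n‖ ≤ q n) → ∀ {z : ℂ}, ‖z‖ ≤ r →
      Summable fun n => a n * z ^ n := fun ha z hz =>
    .of_norm_bounded hq fun n => (norm_mul_pow_le_of_norm_le hz _ n).trans (by
      gcongr; exact ha n)
  refine Metric.tendstoUniformlyOn_iff.2 fun ε hε => ?_
  filter_upwards [hlim.eventually_lt_const hε] with k hk z hz
  refine lt_of_le_of_lt ?_ hk
  rw [dist_eq_norm, ← (hsum hc hz).tsum_sub (hsum (hb k) hz)]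
  refine tsum_of_norm_bounded (Summable.hasSum ?_) fun n => ?_
  · exact .of_nonneg_of_le (fun n => by positivity) (fun n => by
      rw [← mul_assoc]
      gcongr
      linarith [norm_sub_le (c n) (b k n), hb k n, hc n]) (hq.mul_left 2)
  · rw [← sub_mul]
    exact norm_mul_pow_le_of_norm_le hz _ n

end ClusterExpansion

end RepulsiveGas

theorem mainTheorem4 {d : ℕ} (hd : 1 ≤ d) (β : ℝ) (hβ : 0 < β)
    (φ : RepulsiveGas.Space d → RepulsiveGas.Space d → ℝ≥0∞)
    (hφ : RepulsiveGas.IsInteraction φ)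
    (hC : RepulsiveGas.temperedness β φ < ⊤)
    (μ : ℝ) (hμ : 0 < μ) (D : Set ℂ)
    (hD : D = {z : ℂ | ‖z‖ ≤ μ / RepulsiveGas.vertexSum β φ μ}) :
    ∃ (P : Set (RepulsiveGas.Space d) → ℂ → ℂ) (b : ℕ → ℂ) (p : ℂ → ℂ),
      -- `P Λ` is the finite-volume pressure `β P_Λ`, well defined on `D`
      (∀ Λ, RepulsiveGas.IsRegion Λ → RepulsiveGas.IsPressure β φ Λ D (P Λ)) ∧
      -- `b n` is the thermodynamic limit of `b_n(Λ)`
      (∀ Λ : ℕ → Set (RepulsiveGas.Space d), RepulsiveGas.IsVanHove Λ → ∀ n,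
        Tendsto (fun k => RepulsiveGas.clusterCoeff β φ (Λ k) n) atTop (𝓝 (b n))) ∧
      -- `p` is the thermodynamic limit of the pressures, uniformly on `D`
      (∀ Λ : ℕ → Set (RepulsiveGas.Space d), RepulsiveGas.IsVanHove Λ →
        TendstoUniformlyOn (fun k => P (Λ k)) p atTop D) ∧
      -- the finite-volume expansions converge to the pressures, uniformly in `z` and in `Λ`
      TendstoUniformlyOn
        (fun N (q : Set (RepulsiveGas.Space d) × ℂ) =>
          RepulsiveGas.partialExpansion (RepulsiveGas.clusterCoeff β φ q.1) N q.2)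
        (fun q => P q.1 q.2) atTop {q | RepulsiveGas.IsRegion q.1 ∧ q.2 ∈ D} ∧
      -- the infinite-volume expansion converges to the pressure, uniformly in `z`
      TendstoUniformlyOn (fun N => RepulsiveGas.partialExpansion b N) p atTop D ∧
      -- the bounds
      (∀ Λ, RepulsiveGas.IsRegion Λ → ∀ z ∈ D, ‖P Λ z‖ ≤ μ) ∧
      (∀ z ∈ D, ‖p z‖ ≤ μ) := by
  open RepulsiveGas in
  subst hD
  set r := μ / vertexSum β φ μ with hr_def
  have hr : 0 < r := hφ.radius_pos hβ hμ
  have hq : Summable fun n => limitCorr β φ n * r ^ n := hφ.summable_limitCorr hβ hC hμ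
  have hcoeff : ∀ {Λ}, IsRegion Λ → ∀ n,
      clusterCoeff β φ Λ n / (n.factorial : ℂ) = expansionCoeff (meanCorr β φ Λ) n :=
    fun hΛ n => hφ.clusterCoeff_div_factorial hβ hC hΛ n
  have hfac : ∀ n : ℕ, (n.factorial : ℂ) ≠ 0 := fun n => by exact_mod_cast n.factorial_ne_zero
  have hclus : ∀ {Λ}, IsRegion Λ → ∀ n,
      clusterCoeff β φ Λ n = n.factorial * expansionCoeff (meanCorr β φ Λ) n := fun hΛ n => by
    rw [← hcoeff hΛ, mul_div_cancel₀ _ (hfac n)]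
  have hbdiv : ∀ n : ℕ, (n.factorial : ℂ) * expansionCoeff (limitCorr β φ) n / n.factorial =
      expansionCoeff (limitCorr β φ) n := fun n => mul_div_cancel_left₀ _ (hfac n)
  -- Both bounds of part (ii) at once: `c` will be the finite-volume or the infinite-volume
  -- coefficients.
  have hbound : ∀ {c : ℕ → ℝ}, (∀ n, 0 ≤ c n) → (∀ n, c n ≤ limitCorr β φ n) →
      ∀ {z : ℂ}, ‖z‖ ≤ r → ‖∑' n, expansionCoeff c n * z ^ n‖ ≤ μ := fun h0 h1 z hz =>
    (tsum_of_norm_bounded hq.hasSum fun n => norm_expansionCoeff_mul_pow_le h0 h1 hz n).trans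
      (hφ.tsum_limitCorr_le hβ hC hμ)
  have hnorm : ∀ {c : ℕ → ℝ}, (∀ n, 0 ≤ c n) → (∀ n, c n ≤ limitCorr β φ n) →
      ∀ n, ‖expansionCoeff c n‖ ≤ limitCorr β φ n := fun h0 h1 n =>
    (norm_expansionCoeff_le _ n).trans ((abs_of_nonneg (h0 n)).trans_le (h1 n))
  have hlim : ∀ {Λ : ℕ → Set (Space d)}, IsVanHove Λ → ∀ n, Tendsto
      (fun k => expansionCoeff (meanCorr β φ (Λ k)) n) atTop
      (𝓝 (expansionCoeff (limitCorr β φ) n)) := fun hΛ n =>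
    (((Complex.continuous_ofReal.tendsto _).comp
      (hφ.tendsto_meanCorr hβ hC hΛ n)).const_mul _).div_const _
  refine ⟨fun Λ z => ∑' n, expansionCoeff (meanCorr β φ Λ) n * z ^ n,
    fun n => n.factorial * expansionCoeff (limitCorr β φ) n,
    fun z => ∑' n, expansionCoeff (limitCorr β φ) n * z ^ n, fun Λ hΛ => ⟨?_, ?_, ?_⟩,
    fun Λ hΛ n => ?_, fun Λ hΛ => ?_, ?_, ?_, fun Λ hΛ z hz => ?_, fun z hz => ?_⟩
  · have hs : Summable fun n => ‖expansionCoeff (meanCorr β φ Λ) n‖ * r ^ n :=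
      .of_nonneg_of_le (fun n => by positivity) (fun n => by
        gcongr
        exact hnorm (meanCorr_nonneg Λ) (hφ.meanCorr_le hβ hC Λ) n) hq
    refine (continuousOn_tsum_mul_pow hs).mono fun z hz => ?_
    simpa using hz
  · exact (tsum_mul_zero_pow _).trans (expansionCoeff_zero _)
  · exact fun z hz => hφ.exp_tsum_expansionCoeff hβ hC hμ hΛ hz
  · simp only [hclus (hΛ.isRegion _)]
    exact (hlim hΛ n).const_mul _
  · exact tendstoUniformlyOn_tsum_mul_pow hr.le hq
      (fun k => hnorm (meanCorr_nonneg (Λ k)) (hφ.meanCorr_le hβ hC (Λ k)))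
      (hnorm limitCorr_nonneg fun _ => le_rfl) (hlim hΛ)
  · refine (tendstoUniformlyOn_partialExpansion
      (b := fun q : Set (Space d) × ℂ => clusterCoeff β φ q.1) (w := Prod.snd) hq
      (fun q hq' => ?_) fun n q hq' => ?_).congr_right fun q hq' => ?_
    · rw [hclus hq'.1, expansionCoeff_zero, mul_zero]
    · rw [hcoeff hq'.1]
      exact norm_expansionCoeff_mul_pow_le (meanCorr_nonneg _) (hφ.meanCorr_le hβ hC _) hq'.2 n
    · simp only [hcoeff hq'.1]
  · refine (tendstoUniformlyOn_partialExpansion (w := id)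
      (b := fun (_ : ℂ) n => (n.factorial : ℂ) * expansionCoeff (limitCorr β φ) n) hq
      (fun z _ => ?_) fun n z hz => ?_).congr_right fun z _ => ?_
    · rw [expansionCoeff_zero, mul_zero]
    · rw [hbdiv]
      exact norm_expansionCoeff_mul_pow_le limitCorr_nonneg (fun _ => le_rfl) hz n
    · simp only [hbdiv, id]
  · exact hbound (meanCorr_nonneg Λ) (hφ.meanCorr_le hβ hC Λ) hz
  · exact hbound limitCorr_nonneg (fun _ => le_rfl) hz
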